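/- All graphs are finite and simple. A non-complete graph $G$ is $(C_4,K_{1,2})$-co-critical if its edges can be coloured red and blue so that there is no red copy of $C_4$ and no blue copy of $K_{1,2}$ (copies need not be induced), but for every edge $e$ of the complement of $G$ the graph $G+e$ has no such colouring. For every $n\ge 5$, every $(C_4,K_{1,2})$-co-critical graph on $n$ vertices has at least $2n-3$ edges. This bound is sharp for all $n\ge 5$: for every $n\ge 5$ there exists a $(C_4,K_{1,2})$-co-critical graph on $n$ vertices with exactly $2n-3$ edges. -/

import Mathlib

namespace CoCritical

open SimpleGraph

/-- A 2-coloring `τ` of the edges of `G` (`true` is read as red, `false` as blue) is a critical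
coloring with respect to `(H₁, H₂)` if it has neither a red `H₁` nor a blue `H₂`: the spanning
subgraph of red edges has no (not necessarily induced) copy of `H₁`, and the spanning subgraph of
blue edges has no copy of `H₂`. -/
def IsCriticalColoring {V W₁ W₂ : Type*} (H₁ : SimpleGraph W₁) (H₂ : SimpleGraph W₂)
    (G : SimpleGraph V) (τ : G.EdgeLabeling Bool) : Prop :=
  H₁.Free (τ.labelGraph true) ∧ H₂.Free (τ.labelGraph false)

/-- `G` admits a critical coloring with respect to `(H₁, H₂)`, that is, `G ↛ (H₁, H₂)`. -/
def HasCriticalColoring {V W₁ W₂ : Type*} (H₁ : SimpleGraph W₁) (H₂ : SimpleGraph W₂)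
    (G : SimpleGraph V) : Prop :=
  ∃ τ : G.EdgeLabeling Bool, IsCriticalColoring H₁ H₂ G τ

/-- A graph `G` is `(H₁, H₂)`-co-critical if it is not complete, it admits a critical coloring, and
`G + e` has no critical coloring for every edge `e = xy` of the complement of `G`. -/
structure IsCoCritical {V W₁ W₂ : Type*} (H₁ : SimpleGraph W₁) (H₂ : SimpleGraph W₂)
    (G : SimpleGraph V) : Prop where
  not_complete : G ≠ ⊤
  hasCriticalColoring : HasCriticalColoring H₁ H₂ G
  add_edge : ∀ x y : V, Gᶜ.Adj x y → ¬ HasCriticalColoring H₁ H₂ (G ⊔ SimpleGraph.edge x y)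

/-- The cycle `C₄`. -/
abbrev C4 : SimpleGraph (Fin 4) := SimpleGraph.cycleGraph 4

/-- The star `K_{1,k}`. -/
abbrev K1 (k : ℕ) : SimpleGraph (Fin 1 ⊕ Fin k) := completeBipartiteGraph (Fin 1) (Fin k)

end CoCritical

/-! Lower bound. Among the critical colourings of `G`, take one with maximal red graph `R`. Joining
two vertices nonadjacent in `R` by a red edge must create a red C₄: by maximality if the pair is an
edge of `G`, by co-criticality otherwise. Hence `R` is C₄-free and `PathSaturated`. The blue edges
form a matching; let `A` be the set of vertices it misses. Co-criticality also makes `A` a red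
clique, so |A| ≤ 3, and `IsFlexible`. Since 2e(G) = ∑ deg_R + n - |A|, it suffices to show 3n + |A|
≤ ∑ deg_R + 7 (`three_mul_card_add_card_le`): then 2e(G) ≥ 4n - 7, and integrality gives e(G) ≥ 2n -
3.

This inequality is proved by discharging. Vertices are layered by distance from a root `x` of degree
one or two, and each red edge hands its two units to its farther endpoint, or splits them within a
layer. Saturation gives three units to all but a few vertices; flexibility produces surplus when |A|
is large. The root is a leaf if there is one, else a degree-two vertex with nonadjacent neighbours,
else any degree-two vertex, all of these then lying in triangles. Minimum degree three is immediate.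

Sharpness. For n ≥ 7 a hub is joined to a short path and an even cycle; n = 5 and n = 6 use `book`
and `sun`. Colourings after adding an edge are excluded by local obstructions such as K₄. -/

namespace CoCritical

open SimpleGraph

/-! ### Critical colourings as red subgraphs. -/

section

variable {V : Type*}

/-- Every closed walk of length four is degenerate, that is, the graph has no copy of `C₄`. -/
def NoC4 (R : SimpleGraph V) : Prop :=
  ∀ a b c d, R.Adj a b → R.Adj b c → R.Adj c d → R.Adj d a → a = c ∨ b = d

/-- Every vertex has at most one neighbour. -/
def AtMostOne (B : SimpleGraph V) : Prop :=
  ∀ v u w, B.Adj v u → B.Adj v w → u = w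

theorem c4_free_iff (R : SimpleGraph V) : C4.Free R ↔ NoC4 R := by
  constructor
  · intro h a b c d hab hbc hcd hda
    by_contra! hne
    refine h ⟨⟨⟨![a, b, c, d], ?_⟩, ?_⟩⟩
    · intro i j hij
      fin_cases i <;> fin_cases j <;>
        first
        | simpa using hab
        | simpa using hab.symm
        | simpa using hbc
        | simpa using hbc.symm
        | simpa using hcd
        | simpa using hcd.symm
        | simpa using hda
        | simpa using hda.symm
        | exact absurd hij (by rw [cycleGraph_adj]; decide)
    · intro i j hij
      have h1 := hab.ne
      have h2 := hbc.ne
      have h3 := hcd.ne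
      have h4 := hda.ne
      fin_cases i <;> fin_cases j <;> simp_all
  · rintro h ⟨f⟩
    have hadj : ∀ i j : Fin 4, C4.Adj i j → R.Adj (f i) (f j) := fun i j hij => f.toHom.map_rel hij
    rcases h (f 0) (f 1) (f 2) (f 3) (hadj _ _ (by rw [cycleGraph_adj]; decide))
      (hadj _ _ (by rw [cycleGraph_adj]; decide)) (hadj _ _ (by rw [cycleGraph_adj]; decide))
      (hadj _ _ (by rw [cycleGraph_adj]; decide)) with h | h
    · exact absurd (f.injective h) (by decide)
    · exact absurd (f.injective h) (by decide)

theorem star_two_free_iff (B : SimpleGraph V) : (K1 2).Free B ↔ AtMostOne B := by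
  constructor
  · intro h v u w hu hw
    by_contra hne
    refine h ⟨⟨⟨Sum.elim (fun _ => v) ![u, w], ?_⟩, ?_⟩⟩
    · rintro (i | i) (j | j) hij
      · simp at hij
      · fin_cases j
        · simpa using hu
        · simpa using hw
      · fin_cases i
        · simpa using hu.symm
        · simpa using hw.symm
      · simp at hij
    · have h1 := hu.ne
      have h2 := hw.ne
      rintro (i | i) (j | j) hij
      · exact congrArg _ (Subsingleton.elim _ _)
      · fin_cases j <;> simp_all
      · fin_cases i <;> simp_all
      · fin_cases i <;> fin_cases j <;> simp_all
  · rintro h ⟨f⟩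
    have hadj : ∀ j : Fin 2, B.Adj (f (.inl 0)) (f (.inr j)) :=
      fun j => f.toHom.map_rel (by simp)
    have := f.injective (h _ _ _ (hadj 0) (hadj 1))
    simp at this

/-- A critical colouring is the choice of the subgraph of red edges. -/
theorem hasCriticalColoring_iff (G : SimpleGraph V) :
    HasCriticalColoring C4 (K1 2) G ↔ ∃ R ≤ G, NoC4 R ∧ AtMostOne (G \ R) := by
  classical
  constructor
  · rintro ⟨τ, h1, h2⟩
    refine ⟨τ.labelGraph true, τ.labelGraph_le, (c4_free_iff _).1 h1, ?_⟩
    have : G \ τ.labelGraph true = τ.labelGraph false := by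
      ext u v
      simp only [sdiff_adj, EdgeLabeling.labelGraph_adj]
      constructor
      · rintro ⟨h, hn⟩
        exact ⟨h, by simpa [h] using hn⟩
      · rintro ⟨h, hn⟩
        exact ⟨h, by simp [h, hn]⟩
    rw [this]
    exact (star_two_free_iff _).1 h2
  · rintro ⟨R, hle, hR, hB⟩
    let τ : G.EdgeLabeling Bool := fun e => decide (e.1 ∈ R.edgeSet)
    have hτ : ∀ k u v, (τ.labelGraph k).Adj u v ↔ ∃ _ : G.Adj u v, decide (R.Adj u v) = k :=
      fun k u v => EdgeLabeling.labelGraph_adj u v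
    have hred : τ.labelGraph true = R := by
      ext u v
      rw [hτ]
      exact ⟨fun ⟨_, h⟩ => of_decide_eq_true h, fun h => ⟨hle h, decide_eq_true h⟩⟩
    have hblue : τ.labelGraph false = G \ R := by
      ext u v
      rw [hτ, sdiff_adj]
      exact ⟨fun ⟨h, h'⟩ => ⟨h, of_decide_eq_false h'⟩, fun h => ⟨h.1, decide_eq_false h.2⟩⟩
    refine ⟨τ, ?_, ?_⟩
    · rwa [hred, c4_free_iff]
    · rwa [hblue, star_two_free_iff]

theorem isCoCritical_iff (G : SimpleGraph V) :
    IsCoCritical C4 (K1 2) G ↔ G ≠ ⊤ ∧ (∃ R ≤ G, NoC4 R ∧ AtMostOne (G \ R)) ∧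
      ∀ x y, x ≠ y → ¬ G.Adj x y → ∀ R ≤ G ⊔ edge x y, NoC4 R → ¬ AtMostOne ((G ⊔ edge x y) \ R) := by
  constructor
  · rintro ⟨h1, h2, h3⟩
    refine ⟨h1, (hasCriticalColoring_iff G).1 h2, fun x y hxy hG R hR hC hA => ?_⟩
    exact h3 x y (by simp [hxy, hG]) ((hasCriticalColoring_iff _).2 ⟨R, hR, hC, hA⟩)
  · rintro ⟨h1, h2, h3⟩
    refine ⟨h1, (hasCriticalColoring_iff G).2 h2, fun x y hxy hG => ?_⟩
    obtain ⟨R, hR, hC, hA⟩ := (hasCriticalColoring_iff _).1 hG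
    rw [compl_adj] at hxy
    exact h3 x y hxy.1 hxy.2 R hR hC hA

/-! ### Discharging along a level function. -/

section Charge

open Classical in
/-- Each edge gives two units to its endpoint of larger level, or one unit to each endpoint if their
levels agree. -/
noncomputable def charge [Fintype V] (R : SimpleGraph V) (l : V → ℕ) (v : V) : ℕ :=
  2 * (Finset.univ.filter fun w => R.Adj v w ∧ l w < l v).card +
    (Finset.univ.filter fun w => R.Adj v w ∧ l w = l v).card

-- An edge between different levels is counted once going up and once going down, so counting the
-- downward edges twice recovers the degree sum.
open Classical in
theorem sum_charge [Fintype V] (R : SimpleGraph V) (l : V → ℕ) :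
    ∑ v, charge R l v = ∑ v, R.degree v := by
  have key : ∀ v, charge R l v + (Finset.univ.filter fun w => R.Adj v w ∧ l v < l w).card =
      R.degree v + (Finset.univ.filter fun w => R.Adj v w ∧ l w < l v).card := by
    intro v
    have : R.degree v = (Finset.univ.filter fun w => R.Adj v w ∧ l w < l v).card +
        (Finset.univ.filter fun w => R.Adj v w ∧ l w = l v).card +
        (Finset.univ.filter fun w => R.Adj v w ∧ l v < l w).card := by
      rw [← card_neighborFinset_eq_degree, ← Finset.card_union_of_disjoint,
        ← Finset.card_union_of_disjoint]
      · congr 1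
        ext w
        simp only [mem_neighborFinset, Finset.mem_union, Finset.mem_filter, Finset.mem_univ,
          true_and]
        have := lt_trichotomy (l w) (l v)
        tauto
      · rw [Finset.disjoint_left]
        intro w hw hw'
        simp only [Finset.mem_union, Finset.mem_filter, Finset.mem_univ, true_and] at hw hw'
        omega
      · rw [Finset.disjoint_left]
        intro w hw hw'
        simp only [Finset.mem_filter, Finset.mem_univ, true_and] at hw hw'
        omega
    unfold charge
    omega
  have hsum := Finset.sum_congr (rfl : (Finset.univ : Finset V) = Finset.univ) fun v _ => key v
  rw [Finset.sum_add_distrib, Finset.sum_add_distrib] at hsum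
  have hswap : ∑ v, (Finset.univ.filter fun w => R.Adj v w ∧ l v < l w).card =
      ∑ v, (Finset.univ.filter fun w => R.Adj v w ∧ l w < l v).card := by
    simp only [Finset.card_filter]
    rw [Finset.sum_comm]
    simp only [R.adj_comm]
  omega

variable [Fintype V] {R : SimpleGraph V} {l : V → ℕ} {v w t t' : V}

theorem two_le_charge (hw : R.Adj v w) (hl : l w < l v) : 2 ≤ charge R l v := by
  classical
  have : 0 < (Finset.univ.filter fun w => R.Adj v w ∧ l w < l v).card :=
    Finset.card_pos.2 ⟨w, by simp [hw, hl]⟩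
  unfold charge
  convert (by omega : 2 ≤ 2 * (Finset.univ.filter fun w => R.Adj v w ∧ l w < l v).card +
    (Finset.univ.filter fun w => R.Adj v w ∧ l w = l v).card)

theorem three_le_charge (hw : R.Adj v w) (hl : l w < l v) (ht : R.Adj v t) (hlt : l t = l v) :
    3 ≤ charge R l v := by
  classical
  have : 0 < (Finset.univ.filter fun w => R.Adj v w ∧ l w < l v).card :=
    Finset.card_pos.2 ⟨w, by simp [hw, hl]⟩
  have : 0 < (Finset.univ.filter fun w => R.Adj v w ∧ l w = l v).card :=
    Finset.card_pos.2 ⟨t, by simp [ht, hlt]⟩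
  unfold charge
  convert (by omega : 3 ≤ 2 * (Finset.univ.filter fun w => R.Adj v w ∧ l w < l v).card +
    (Finset.univ.filter fun w => R.Adj v w ∧ l w = l v).card)

theorem four_le_charge (hw : R.Adj v w) (hl : l w < l v) (ht : R.Adj v t) (hlt : l t = l v)
    (ht' : R.Adj v t') (hlt' : l t' = l v) (hne : t ≠ t') : 4 ≤ charge R l v := by
  classical
  have : 0 < (Finset.univ.filter fun w => R.Adj v w ∧ l w < l v).card :=
    Finset.card_pos.2 ⟨w, by simp [hw, hl]⟩
  have : 1 < (Finset.univ.filter fun w => R.Adj v w ∧ l w = l v).card :=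
    Finset.one_lt_card.2 ⟨t, by simp [ht, hlt], t', by simp [ht', hlt'], hne⟩
  unfold charge
  convert (by omega : 4 ≤ 2 * (Finset.univ.filter fun w => R.Adj v w ∧ l w < l v).card +
    (Finset.univ.filter fun w => R.Adj v w ∧ l w = l v).card)

open Classical in
theorem charge_eq_add_degree (h : ∀ w, R.Adj v w → l w ≤ l v) :
    charge R l v = (Finset.univ.filter fun w => R.Adj v w ∧ l w < l v).card + R.degree v := by
  have : R.degree v = (Finset.univ.filter fun w => R.Adj v w ∧ l w < l v).card +
      (Finset.univ.filter fun w => R.Adj v w ∧ l w = l v).card := by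
    rw [← card_neighborFinset_eq_degree, ← Finset.card_union_of_disjoint]
    · congr 1
      ext w
      simp only [mem_neighborFinset, Finset.mem_union, Finset.mem_filter, Finset.mem_univ,
        true_and]
      have := h w
      have := @Nat.lt_or_eq_of_le (l w) (l v)
      tauto
    · rw [Finset.disjoint_left]
      intro w hw hw'
      simp only [Finset.mem_filter, Finset.mem_univ, true_and] at hw hw'
      omega
  unfold charge
  omega

end Charge

end

/-! ### Saturation, flexible sets and distance levels. -/

section

variable {V : Type*}

/-- Any two distinct nonadjacent vertices are joined by a path of length three. -/
def PathSaturated (R : SimpleGraph V) : Prop :=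
  ∀ u v, u ≠ v → ¬ R.Adj u v → ∃ s t, R.Adj u s ∧ R.Adj s t ∧ R.Adj t v ∧ t ≠ u ∧ s ≠ v

/-- Any two vertices `p`, `q` of `A` are adjacent, and every nonneighbour of `p` is joined to `p` by
a path of length three that does not end with the edge `qp`. -/
def IsFlexible (R : SimpleGraph V) (A : Finset V) : Prop :=
  ∀ p ∈ A, ∀ q ∈ A, p ≠ q → R.Adj p q ∧ ∀ x, x ≠ p → ¬ R.Adj x p →
    ∃ s t, R.Adj x s ∧ R.Adj s t ∧ R.Adj t p ∧ t ≠ x ∧ s ≠ p ∧ t ≠ q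

theorem NoC4.clique_card_le {R : SimpleGraph V} (hC : NoC4 R) {K : Finset V}
    (hK : ∀ a ∈ K, ∀ b ∈ K, a ≠ b → R.Adj a b) : K.card ≤ 3 := by
  classical
  by_contra! h
  obtain ⟨a, ha, b, hb, c, hc, hab, hac, hbc⟩ := Finset.two_lt_card.1 (by omega : 2 < K.card)
  obtain ⟨d, hd, hd'⟩ := Finset.exists_mem_notMem_of_card_lt_card
    (lt_of_le_of_lt Finset.card_le_three h : ({a, b, c} : Finset V).card < K.card)
  simp only [Finset.mem_insert, Finset.mem_singleton, not_or] at hd'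
  rcases hC a b c d (hK _ ha _ hb hab) (hK _ hb _ hc hbc) (hK _ hc _ hd (Ne.symm hd'.2.2))
    (hK _ hd _ ha hd'.1) with h | h
  · exact hac h
  · exact hd'.2.1 h.symm

open Classical in
/-- The distance from `x`, truncated at three. -/
noncomputable def level (R : SimpleGraph V) (x v : V) : ℕ :=
  if v = x then 0 else if R.Adj x v then 1 else if ∃ w, R.Adj x w ∧ R.Adj w v then 2 else 3

section Level

variable {R : SimpleGraph V} {x v w s : V}

theorem level_le_three : level R x v ≤ 3 := by
  unfold level; split_ifs <;> omega

theorem level_eq_zero : level R x v = 0 ↔ v = x := by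
  unfold level; split_ifs <;> simp_all

theorem level_self : level R x x = 0 := level_eq_zero.2 rfl

theorem level_eq_one : level R x v = 1 ↔ R.Adj x v := by
  unfold level; split_ifs with h <;> simp_all

theorem level_eq_two :
    level R x v = 2 ↔ v ≠ x ∧ ¬ R.Adj x v ∧ ∃ w, R.Adj x w ∧ R.Adj w v := by
  unfold level; split_ifs <;> simp_all

theorem two_le_level : 2 ≤ level R x v ↔ v ≠ x ∧ ¬ R.Adj x v := by
  unfold level; split_ifs <;> simp_all

theorem two_le_level_of_adj (hv : level R x v = 3) (h : R.Adj v w) : 2 ≤ level R x w := by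
  have h3 : ¬ (level R x v = 0) ∧ ¬ (level R x v = 1) ∧ ¬ (level R x v = 2) := by omega
  rw [level_eq_zero, level_eq_one, level_eq_two] at h3
  rw [two_le_level]
  refine ⟨?_, fun hw => h3.2.2 ⟨h3.1, h3.2.1, w, hw, h.symm⟩⟩
  rintro rfl
  exact h3.2.1 h.symm

theorem level_eq_two_of_adj (hs : R.Adj x s) (hv : R.Adj s v) (h : 2 ≤ level R x v) :
    level R x v = 2 := by
  rw [two_le_level] at h
  exact level_eq_two.2 ⟨h.1, h.2, s, hs, hv⟩

theorem level_eq_two_of_independent (hI : ∀ a b, R.Adj x a → R.Adj x b → ¬ R.Adj a b)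
    (hs : R.Adj x s) (hv : R.Adj s v) (hvx : v ≠ x) : level R x v = 2 :=
  level_eq_two.2 ⟨hvx, fun h => hI s v hs h hv, s, hs, hv⟩

variable [Fintype V]

open Classical in
theorem charge_of_level_three (hv : level R x v = 3) : charge R (level R x) v =
    (Finset.univ.filter fun w => R.Adj v w ∧ level R x w < level R x v).card + R.degree v :=
  charge_eq_add_degree fun _ _ => hv ▸ level_le_three

-- No level exceeds three, so the charge is the degree plus the number of lower neighbours. A
-- length-three path from `x` to `v` has its penultimate vertex on level two, so there is a lower
-- neighbour.
open Classical in
theorem degree_lt_charge (hS : PathSaturated R) (hv : level R x v = 3) :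
    R.degree v < charge R (level R x) v := by
  have h2 := two_le_level.1 (by omega : 2 ≤ level R x v)
  obtain ⟨s, t, hs, hst, htv, htx, -⟩ := hS x v (Ne.symm h2.1) h2.2
  have ht : level R x t = 2 := level_eq_two_of_adj hs hst (two_le_level_of_adj hv htv.symm)
  rw [charge_of_level_three hv]
  have : 0 < (Finset.univ.filter fun w => R.Adj v w ∧ level R x w < level R x v).card :=
    Finset.card_pos.2 ⟨t, by simp [htv.symm, ht, hv]⟩
  omega

theorem four_le_charge_of_two_lower {t t' : V} (hv : level R x v = 3) (ht : R.Adj v t)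
    (ht' : R.Adj v t') (hl : level R x t = 2) (hl' : level R x t' = 2) (hne : t ≠ t') :
    4 ≤ charge R (level R x) v := by
  classical
  rw [charge_of_level_three hv]
  have h1 : 1 < (Finset.univ.filter fun w => R.Adj v w ∧ level R x w < level R x v).card :=
    Finset.one_lt_card.2 ⟨t, by simp [ht, hl, hv], t', by simp [ht', hl', hv], hne⟩
  have h2 : 1 < R.degree v := by
    rw [← card_neighborFinset_eq_degree]
    exact Finset.one_lt_card.2 ⟨t, by simpa using ht, t', by simpa using ht', hne⟩
  omega

open Classical in
theorem two_lt_degree {a b c : V} (ha : R.Adj v a) (hb : R.Adj v b) (hc : R.Adj v c)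
    (hab : a ≠ b) (hac : a ≠ c) (hbc : b ≠ c) : 2 < R.degree v := by
  rw [← card_neighborFinset_eq_degree]
  exact Finset.two_lt_card.2 ⟨a, by simpa using ha, b, by simpa using hb, c, by simpa using hc,
    hab, hac, hbc⟩

theorem four_le_charge_of_three_neighbors {a b c : V} (hS : PathSaturated R)
    (hv : level R x v = 3) (ha : R.Adj v a) (hb : R.Adj v b) (hc : R.Adj v c)
    (hab : a ≠ b) (hac : a ≠ c) (hbc : b ≠ c) : 4 ≤ charge R (level R x) v := by
  classical
  have h1 := degree_lt_charge hS hv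
  have h2 := two_lt_degree ha hb hc hab hac hbc
  omega

end Level

/-! ### Roots with independent neighbourhood. -/

section Independent

variable [Fintype V] {R : SimpleGraph V} {x : V}

/-- If `N(x)` is independent, then only `x`, its neighbours, and vertices of degree one can have
charge less than three. -/
theorem three_mul_card_le_of_independent (hS : PathSaturated R) (hdeg : ∀ v, ∃ w, R.Adj v w)
    (hI : ∀ a b, R.Adj x a → R.Adj x b → ¬ R.Adj a b) [DecidableRel R.Adj] [DecidableEq V]
    (X : Finset V) (hX : ∀ v ∈ X, 2 ≤ level R x v ∧ 4 ≤ charge R (level R x) v) :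
    3 * Fintype.card V + X.card ≤ ∑ v, R.degree v + 3 + R.degree x +
      (Finset.univ.filter fun v => R.degree v = 1 ∧ v ≠ x).card := by
  -- The indicators on the right are the shortfalls from three units: three at the root, one at each
  -- neighbour of it, one at each other leaf.
  have key : ∀ v, 3 + (if v ∈ X then 1 else 0) ≤ charge R (level R x) v +
      (if v = x then 3 else 0) + (if R.Adj x v then 1 else 0) +
      (if R.degree v = 1 ∧ v ≠ x then 1 else 0) := by
    intro v
    by_cases hvX : v ∈ X
    · have := hX v hvX
      simp only [hvX, if_true]
      omega
    simp only [hvX, if_false]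
    by_cases hvx : v = x
    · simp [hvx]
    by_cases hxv : R.Adj x v
    · have : 2 ≤ charge R (level R x) v := two_le_charge hxv.symm (by
        rw [level_self, level_eq_one.2 hxv]; omega)
      simp only [hxv, if_true]
      omega
    obtain ⟨s, t, hs, hst, htv, htx, hsv⟩ := hS x v (Ne.symm hvx) hxv
    -- Independence of N(x) forces `t` onto level two, so a level-two `v` gets one unit from `t`
    -- besides two from below.
    have htl := level_eq_two_of_independent hI hs hst htx
    have h2 := two_le_level.2 ⟨hvx, hxv⟩
    rcases (by have := @level_le_three V R x v; omega : level R x v = 2 ∨ level R x v = 3) with h | h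
    · obtain ⟨-, -, w, hw, hwv⟩ := level_eq_two.1 h
      have : 3 ≤ charge R (level R x) v := three_le_charge hwv.symm
        (by rw [level_eq_one.2 hw, h]; omega) htv.symm (htl.trans h.symm)
      omega
    · have h3 := degree_lt_charge hS h
      have h4 : 0 < R.degree v := (R.degree_pos_iff_exists_adj v).2 (hdeg v)
      have h5 : R.degree v < charge R (level R x) v := by convert h3
      by_cases hd : R.degree v = 1
      · simp only [hd, ne_eq, hvx, not_false_eq_true, and_self, if_true]
        omega
      · omega
  have hsum := Finset.sum_le_sum fun v (_ : v ∈ (Finset.univ : Finset V)) => key v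
  simp only [Finset.sum_add_distrib, ← Finset.card_filter] at hsum
  have h1 : ∑ v, charge R (level R x) v = ∑ v, R.degree v := by
    rw [sum_charge]
    congr!
  have h2 : (Finset.univ.filter fun v => R.Adj x v).card = R.degree x := by
    rw [← card_neighborFinset_eq_degree]
    congr 1
    ext; simp
  rw [h1, h2] at hsum
  simp only [Finset.sum_const, Finset.card_univ, smul_eq_mul, Finset.sum_ite_eq', Finset.mem_univ,
    if_true, Finset.filter_univ_mem] at hsum
  omega

/-- The set `A` is a triangle, and flexibility gives each of its vertices on level two or three a
level-two neighbour other than a prescribed vertex of `A`. This extra neighbour yields the fourth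
unit at all but at most one vertex of `A`. -/
theorem exists_two_of_card_eq_three (hS : PathSaturated R)
    (hI : ∀ a b, R.Adj x a → R.Adj x b → ¬ R.Adj a b) {A : Finset V} (hA : IsFlexible R A)
    (hcard : A.card = 3) :
    ∃ X : Finset V, X.card = 2 ∧ ∀ v ∈ X, 2 ≤ level R x v ∧ 4 ≤ charge R (level R x) v := by
  classical
  have third : ∀ p q, ∃ r ∈ A, r ≠ p ∧ r ≠ q := by
    intro p q
    obtain ⟨d, hd, hd'⟩ := Finset.exists_mem_notMem_of_card_lt_card
      (lt_of_le_of_lt Finset.card_le_two (by omega) : ({p, q} : Finset V).card < A.card)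
    simp only [Finset.mem_insert, Finset.mem_singleton, not_or] at hd'
    exact ⟨d, hd, hd'⟩
  have path : ∀ p ∈ A, ∀ q ∈ A, p ≠ q → 2 ≤ level R x p →
      ∃ t, R.Adj p t ∧ level R x t = 2 ∧ t ≠ q := by
    intro p hp q hq hpq hl
    obtain ⟨h1, h2⟩ := two_le_level.1 hl
    obtain ⟨s, t, hs, hst, htp, htx, -, htq⟩ := (hA p hp q hq hpq).2 x h1.symm h2
    exact ⟨t, htp.symm, level_eq_two_of_independent hI hs hst htx, htq⟩
  have good2 : ∀ p ∈ A, ∀ q ∈ A, p ≠ q → level R x p = 2 → level R x q = 2 →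
      4 ≤ charge R (level R x) p := by
    intro p hp q hq hpq hlp hlq
    obtain ⟨t, ht, htl, htq⟩ := path p hp q hq hpq hlp.ge
    obtain ⟨-, -, w, hw, hwp⟩ := level_eq_two.1 hlp
    exact four_le_charge hwp.symm (by rw [level_eq_one.2 hw, hlp]; omega) ht (htl.trans hlp.symm)
      (hA p hp q hq hpq).1 (hlq.trans hlp.symm) htq
  have good3 : ∀ p ∈ A, level R x p = 3 → 4 ≤ charge R (level R x) p := by
    intro p hp hlp
    obtain ⟨q, hq, hqp, -⟩ := third p p
    obtain ⟨r, hr, hrp, hrq⟩ := third p q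
    obtain ⟨t, ht, htl, htq⟩ := path p hp q hq hqp.symm (by omega)
    obtain ⟨t', ht', htl', htr⟩ := path p hp r hr hrp.symm (by omega)
    -- Either `t`, `q`, `r` are three neighbours of `p`, or `t` and `t'` are two lower ones.
    by_cases htt : t = t'
    · subst htt
      exact four_le_charge_of_three_neighbors hS hlp ht (hA p hp q hq hqp.symm).1
        (hA p hp r hr hrp.symm).1 htq htr hrq.symm
    · exact four_le_charge_of_two_lower hlp ht ht' htl htl' htt
  have nogood : ∀ p ∈ A, ∀ q ∈ A, ¬ (2 ≤ level R x p ∧ 4 ≤ charge R (level R x) p) →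
      ¬ (2 ≤ level R x q ∧ 4 ≤ charge R (level R x) q) → level R x p ≤ level R x q → p = q := by
    intro p hp q hq hgp hgq hle
    by_contra hpq
    obtain ⟨r, hr, hrp, hrq⟩ := third p q
    have apq := (hA p hp q hq hpq).1
    have apr := (hA p hp r hr hrp.symm).1
    have aqr := (hA q hq r hr hrq.symm).1
    have small : ∀ v ∈ A, ¬ (2 ≤ level R x v ∧ 4 ≤ charge R (level R x) v) → level R x v ≤ 2 := by
      intro v hv hg
      by_contra hlt
      have h3 : level R x v = 3 := by have := @level_le_three V R x v; omega
      exact hg ⟨by omega, good3 v hv h3⟩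
    have hp2 := small p hp hgp
    have hq2 := small q hq hgq
    have hcases : level R x p = 0 ∨ level R x p = 1 ∨ level R x p = 2 := by omega
    rcases hcases with h | h | h
    · rw [level_eq_zero] at h
      subst h
      exact hI q r apq apr aqr
    · rw [level_eq_one] at h
      have hq' : level R x q = 2 := by
        refine level_eq_two_of_independent hI h apq ?_
        rintro rfl
        rw [level_eq_one.2 h, level_self] at hle
        omega
      have hr' : level R x r = 2 := by
        refine level_eq_two_of_independent hI h apr ?_
        rintro rfl
        rw [level_eq_two] at hq'
        exact hq'.2.1 aqr.symm
      exact hgq ⟨hq'.ge, good2 q hq r hr hrq.symm hq' hr'⟩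
    · exact hgp ⟨h.ge, good2 p hp q hq hpq h (by omega)⟩
  have hone : (A.filter fun v => ¬ (2 ≤ level R x v ∧ 4 ≤ charge R (level R x) v)).card ≤ 1 := by
    rw [Finset.card_le_one]
    intro p hp q hq
    rw [Finset.mem_filter] at hp hq
    rcases le_total (level R x p) (level R x q) with h | h
    · exact nogood p hp.1 q hq.1 hp.2 hq.2 h
    · exact (nogood q hq.1 p hp.1 hq.2 hp.2 h).symm
  have htot := Finset.card_filter_add_card_filter_not (s := A)
    (fun v => 2 ≤ level R x v ∧ 4 ≤ charge R (level R x) v)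
  obtain ⟨X, hX, hXc⟩ := Finset.exists_subset_card_eq (n := 2)
    (s := A.filter fun v => 2 ≤ level R x v ∧ 4 ≤ charge R (level R x) v) (by omega)
  exact ⟨X, hXc, fun v hv => (Finset.mem_filter.1 (hX hv)).2⟩

end Independent

end

/-! ### Vertices of degree one in the red graph. -/

section

variable {V : Type*} [Fintype V] {R : SimpleGraph V}

/-- `a` is the only neighbour of `x`. -/
def IsLeafAt (R : SimpleGraph V) (x a : V) : Prop := ∀ w, R.Adj x w ↔ w = a

/-- Two adjacent leaves would form a component, out of reach of any third vertex. -/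
theorem IsLeafAt.not_adj {x y a b : V} (hx : IsLeafAt R x a) (hy : IsLeafAt R y b)
    (hS : PathSaturated R) (hn : 3 ≤ Fintype.card V) : ¬ R.Adj x y := by
  classical
  intro h
  obtain ⟨v, -, hv⟩ := Finset.exists_mem_notMem_of_card_lt_card
    (lt_of_le_of_lt Finset.card_le_two (by rw [Finset.card_univ]; omega) :
      ({x, y} : Finset V).card < (Finset.univ : Finset V).card)
  simp only [Finset.mem_insert, Finset.mem_singleton, not_or] at hv
  have hya := (hx y).1 h
  have hxb := (hy x).1 h.symm
  obtain ⟨s, t, hs, hst, -, htx, -⟩ := hS x v (Ne.symm hv.1) fun h' =>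
    hv.2 (((hx v).1 h').trans hya.symm)
  rw [hx, ← hya] at hs
  subst hs
  exact htx (((hy t).1 hst).trans hxb.symm)

theorem IsLeafAt.adj_of_ne {x y a b : V} (hx : IsLeafAt R x a) (hy : IsLeafAt R y b)
    (hS : PathSaturated R) (hxy : x ≠ y) (hn : 3 ≤ Fintype.card V) : R.Adj a b := by
  obtain ⟨s, t, hs, hst, hty, -, -⟩ := hS x y hxy (hx.not_adj hy hS hn)
  rw [hx] at hs
  have := (hy t).1 hty.symm
  subst hs this
  exact hst

open Classical in
theorem exists_isLeafAt {x : V} (h : R.degree x = 1) : ∃ a, IsLeafAt R x a := by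
  obtain ⟨a, ha, ha'⟩ := degree_eq_one_iff_existsUnique_adj.1 h
  exact ⟨a, fun w => ⟨ha' w, fun hw => hw ▸ ha⟩⟩

-- The neighbours of distinct leaves are distinct and adjacent, so they form a clique in a C₄-free
-- graph.
open Classical in
theorem card_leaves_le_three (hC : NoC4 R) (hS : PathSaturated R) (hn : 3 ≤ Fintype.card V) :
    (Finset.univ.filter fun v => R.degree v = 1).card ≤ 3 := by
  choose! f hf using fun (v : V) (h : R.degree v = 1) => exists_isLeafAt h
  have hadj : ∀ u, R.degree u = 1 → ∀ v, R.degree v = 1 → u ≠ v → R.Adj (f u) (f v) :=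
    fun u hu v hv huv => (hf u hu).adj_of_ne (hf v hv) hS huv hn
  rw [← Finset.card_image_of_injOn (f := f)]
  · refine hC.clique_card_le ?_
    intro a ha b hb hab
    simp only [Finset.mem_image, Finset.mem_filter, Finset.mem_univ, true_and] at ha hb
    obtain ⟨u, hu, rfl⟩ := ha
    obtain ⟨v, hv, rfl⟩ := hb
    exact hadj u hu v hv fun h => hab (by rw [h])
  · intro u hu v hv huv
    simp only [Finset.coe_filter, Finset.mem_univ, true_and, Set.mem_ofPred_eq] at hu hv
    by_contra hne
    exact (hadj u hu v hv hne).ne huv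

/-- With three vertices of degree one, some vertex at distance at least two from one of them has
excess charge, provided that two vertices are flexible. -/
theorem exists_four_le_charge_of_three_leaves (hC : NoC4 R) (hS : PathSaturated R)
    {x y z a b c : V} (hx : IsLeafAt R x a) (hy : IsLeafAt R y b) (hz : IsLeafAt R z c)
    (hxy : x ≠ y) (hxz : x ≠ z) (hyz : y ≠ z) (hn : 3 ≤ Fintype.card V)
    {A : Finset V} (hA : IsFlexible R A) {p q : V} (hp : p ∈ A) (hq : q ∈ A) (hpq : p ≠ q) :
    ∃ v, 2 ≤ level R x v ∧ 4 ≤ charge R (level R x) v := by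
  have hab := hx.adj_of_ne hy hS hxy hn
  have hac := hx.adj_of_ne hz hS hxz hn
  have hbc := hy.adj_of_ne hz hS hyz hn
  have path : ∀ p ∈ A, ∀ q ∈ A, p ≠ q → ∀ w d, IsLeafAt R w d → p ≠ w → p ≠ d →
      ∃ t, R.Adj d t ∧ R.Adj t p ∧ t ≠ q := by
    intro p hp q hq hpq w d hw hpw hpd
    obtain ⟨s, t, hs, hst, htp, -, -, htq⟩ :=
      (hA p hp q hq hpq).2 w hpw.symm fun h => hpd ((hw p).1 h)
    rw [hw] at hs
    subst hs
    exact ⟨t, hst, htp, htq⟩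
  -- A flexible leaf could be entered only through its neighbour `q`, which flexibility forbids.
  have notLeaf : ∀ p ∈ A, ∀ q ∈ A, p ≠ q → ∀ w d w' d', IsLeafAt R w d → IsLeafAt R w' d' →
      w ≠ w' → p ≠ w := by
    intro p hp q hq hpq w d w' d' hw hw' hww hpw
    subst hpw
    have hqd := (hw q).1 (hA p hp q hq hpq).1
    have hpd : p ≠ d' := fun h => hw.not_adj hw' hS hn ((hw' p).2 h).symm
    obtain ⟨t, -, htp, htq⟩ := path p hp q hq hpq w' d' hw' hww hpd
    exact htq (((hw t).1 htp.symm).trans hqd.symm)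
  have notLeaves : ∀ p ∈ A, ∀ q ∈ A, p ≠ q → p ≠ x ∧ p ≠ y ∧ p ≠ z :=
    fun p hp q hq hpq => ⟨notLeaf p hp q hq hpq x a y b hx hy hxy,
      notLeaf p hp q hq hpq y b x a hy hx hxy.symm, notLeaf p hp q hq hpq z c x a hz hx hxz.symm⟩
  have main : ∀ p ∈ A, ∀ q ∈ A, p ≠ q → p ≠ a → p ≠ b → p ≠ c →
      ∃ v, 2 ≤ level R x v ∧ 4 ≤ charge R (level R x) v := by
    intro p hp q hq hpq hpa hpb hpc
    have adj : R.Adj p q := (hA p hp q hq hpq).1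
    obtain ⟨hpx, hpy, hpz⟩ := notLeaves p hp q hq hpq
    obtain ⟨t, hat, htp, htq⟩ := path p hp q hq hpq x a hx hpx hpa
    obtain ⟨t', hbt, htp', htq'⟩ := path p hp q hq hpq y b hy hpy hpb
    obtain ⟨t'', hct, htp'', htq''⟩ := path p hp q hq hpq z c hz hpz hpc
    have hlp : 2 ≤ level R x p := two_le_level.2 ⟨hpx, fun h => hpa ((hx p).1 h)⟩
    by_cases hap : R.Adj a p
    · by_cases hqa : q = a
      · exfalso
        subst hqa
        rcases hC q b t' p hab hbt htp' hap.symm with h | h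
        · exact htq' h.symm
        · exact hpb h.symm
      have haq : ¬ R.Adj a q := by
        intro haq
        rcases hC a t p q hat htp adj haq.symm with h | h
        · exact hpa h.symm
        · exact htq h
      have hlp2 : level R x p = 2 := level_eq_two_of_adj ((hx a).2 rfl) hap hlp
      have hqx : q ≠ x := (notLeaves q hq p hp hpq.symm).1
      obtain ⟨s, has, hsq, hsp⟩ := path q hq p hp hpq.symm x a hx hqx hqa
      have hlq : 2 ≤ level R x q := two_le_level.2 ⟨hqx, fun h => hqa ((hx q).1 h)⟩
      have hlq3 : level R x q = 3 := by
        have h2 : level R x q ≠ 2 := by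
          rw [Ne, level_eq_two]
          rintro ⟨-, -, w, hw, hwq⟩
          rw [hx] at hw
          exact haq (hw ▸ hwq)
        have := @level_le_three V R x q
        omega
      have hls : level R x s = 2 :=
        level_eq_two_of_adj ((hx a).2 rfl) has (two_le_level_of_adj hlq3 hsq.symm)
      exact ⟨q, hlq, four_le_charge_of_two_lower hlq3 adj.symm hsq.symm hlp2 hls hsp.symm⟩
    · have hp3 : level R x p = 3 := by
        have h2 : level R x p ≠ 2 := by
          rw [Ne, level_eq_two]
          rintro ⟨-, -, w, hw, hwp⟩
          rw [hx] at hw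
          exact hap (hw ▸ hwp)
        have := @level_le_three V R x p
        omega
      -- If `t`, `t'`, `t''` all coincided, `a b t c` would be a C₄; two distinct ones together with
      -- `q` are three neighbours of `p`.
      by_cases h1 : t = t'
      · by_cases h2 : t = t''
        · subst h1 h2
          rcases hC a b t c hab hbt hct.symm hac.symm with h | h
          · exact absurd h hat.ne
          · exact absurd h hbc.ne
        · exact ⟨p, hlp, four_le_charge_of_three_neighbors hS hp3 htp.symm htp''.symm adj h2 htq htq''⟩
      · exact ⟨p, hlp, four_le_charge_of_three_neighbors hS hp3 htp.symm htp'.symm adj h1 htq htq'⟩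
  -- If `p`, `q` and the neighbour `c` of a leaf form a triangle, the path from that leaf to `p`
  -- avoiding `q` closes the C₄ `p q c t`.
  have pair : ∀ p ∈ A, ∀ q ∈ A, p ≠ q → ∀ w c, IsLeafAt R w c → p ≠ w → R.Adj p q →
      R.Adj q c → R.Adj c p → False := by
    intro p hp q hq hpq w c hw hpw adj hqc hcp
    obtain ⟨t, hct, htp, htq⟩ := path p hp q hq hpq w c hw hpw hcp.ne.symm
    rcases hC p q c t adj hqc hct htp with h | h
    · exact hcp.ne h.symm
    · exact htq h.symm
  by_cases hp' : p ≠ a ∧ p ≠ b ∧ p ≠ c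
  · exact main p hp q hq hpq hp'.1 hp'.2.1 hp'.2.2
  by_cases hq' : q ≠ a ∧ q ≠ b ∧ q ≠ c
  · exact main q hq p hp hpq.symm hq'.1 hq'.2.1 hq'.2.2
  exfalso
  obtain ⟨hpx, hpy, hpz⟩ := notLeaves p hp q hq hpq
  have hp3 : p = a ∨ p = b ∨ p = c := by tauto
  have hq3 : q = a ∨ q = b ∨ q = c := by tauto
  have := pair p hp q hq hpq
  rcases hp3 with rfl | rfl | rfl <;> rcases hq3 with rfl | rfl | rfl
  · exact hpq rfl
  · exact this z c hz hpz hab hbc hac.symm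
  · exact this y b hy hpy hac hbc.symm hab.symm
  · exact this z c hz hpz hab.symm hac hbc.symm
  · exact hpq rfl
  · exact this x a hx hpx hbc hac.symm hab
  · exact this y b hy hpy hac.symm hab hbc
  · exact this x a hx hpx hbc.symm hab.symm hac
  · exact hpq rfl

-- The shortfall is at most 3 + 1 + 2: root, its neighbour, two other leaves. This suffices when |A|
-- ≤ 1, and also when |A| = 2 with at most two leaves; the remaining cases need one or two vertices
-- of surplus charge.
open Classical in
theorem three_mul_card_add_card_le_of_leaf (hC : NoC4 R) (hS : PathSaturated R)
    (hn : 3 ≤ Fintype.card V) (hdeg : ∀ v, ∃ w, R.Adj v w) {A : Finset V} (hA : IsFlexible R A)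
    {x : V} (hx : R.degree x = 1) : 3 * Fintype.card V + A.card ≤ ∑ v, R.degree v + 7 := by
  obtain ⟨a, ha⟩ := exists_isLeafAt hx
  have hI : ∀ u v, R.Adj x u → R.Adj x v → ¬ R.Adj u v := by
    intro u v hu hv huv
    rw [ha] at hu hv
    exact huv.ne (hu.trans hv.symm)
  have hA3 : A.card ≤ 3 := hC.clique_card_le fun p hp q hq hpq => (hA p hp q hq hpq).1
  have hl := card_leaves_le_three hC hS hn
  have herase : (Finset.univ.filter fun v => R.degree v = 1 ∧ v ≠ x).card + 1 =
      (Finset.univ.filter fun v => R.degree v = 1).card := by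
    have h := Finset.card_erase_add_one (s := Finset.univ.filter fun v => R.degree v = 1) (a := x)
      (by simp [hx])
    rw [← h]
    congr 2
    ext v
    simp [and_comm]
  have count := three_mul_card_le_of_independent hS hdeg hI
  by_cases h3 : A.card = 3
  · obtain ⟨X, hX, hX'⟩ := exists_two_of_card_eq_three hS hI hA h3
    have := count X hX'
    omega
  have hcount := count ∅ (by simp)
  rw [Finset.card_empty] at hcount
  by_cases h2 : A.card = 2 ∧ (Finset.univ.filter fun v => R.degree v = 1).card = 3
  · obtain ⟨p, hp, q, hq, hpq⟩ := Finset.one_lt_card.1 (by omega : 1 < A.card)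
    obtain ⟨y, hy, z, hz, hyz⟩ := Finset.one_lt_card.1
      (by omega : 1 < (Finset.univ.filter fun v => R.degree v = 1 ∧ v ≠ x).card)
    simp only [Finset.mem_filter, Finset.mem_univ, true_and] at hy hz
    obtain ⟨b, hb⟩ := exists_isLeafAt hy.1
    obtain ⟨c, hc⟩ := exists_isLeafAt hz.1
    obtain ⟨v, hv⟩ := exists_four_le_charge_of_three_leaves hC hS ha hb hc hy.2.symm hz.2.symm hyz hn
      hA hp hq hpq
    have := count {v} (by simpa using hv)
    rw [Finset.card_singleton] at this
    omega
  · omega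

open Classical in
theorem three_mul_card_add_card_le_of_independent (hC : NoC4 R) (hS : PathSaturated R)
    (hdeg : ∀ v, 2 ≤ R.degree v) {A : Finset V} (hA : IsFlexible R A) {x : V} (hx : R.degree x = 2)
    (hI : ∀ u v, R.Adj x u → R.Adj x v → ¬ R.Adj u v) :
    3 * Fintype.card V + A.card ≤ ∑ v, R.degree v + 7 := by
  have hA3 : A.card ≤ 3 := hC.clique_card_le fun p hp q hq hpq => (hA p hp q hq hpq).1
  have hleaf : (Finset.univ.filter fun v => R.degree v = 1 ∧ v ≠ x).card = 0 := by
    rw [Finset.card_eq_zero, Finset.filter_eq_empty_iff]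
    rintro v - ⟨h, -⟩
    have := hdeg v
    omega
  have count := three_mul_card_le_of_independent hS
    (fun v => (R.degree_pos_iff_exists_adj v).1 (by have := hdeg v; omega)) hI
  by_cases h3 : A.card = 3
  · obtain ⟨X, hX, hX'⟩ := exists_two_of_card_eq_three hS hI hA h3
    have := count X hX'
    omega
  · have := count ∅ (by simp)
    omega

end

/-! ### Degree-two vertices all lying in triangles. -/

section

variable {V : Type*} [Fintype V] {R : SimpleGraph V}

open Classical in
theorem eq_or_eq_of_degree_eq_two {v u w : V} (hv : R.degree v = 2) (hu : R.Adj v u)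
    (hw : R.Adj v w) (huw : u ≠ w) {t : V} (ht : R.Adj v t) : t = u ∨ t = w := by
  by_contra! h
  have := two_lt_degree hu hw ht huw h.1.symm h.2.symm
  omega

open Classical in
/-- The level-two vertices without a neighbour of level two. -/
noncomputable def deficient (R : SimpleGraph V) (x : V) : Finset V :=
  Finset.univ.filter fun v => level R x v = 2 ∧ ∀ t, R.Adj v t → level R x t ≠ 2

theorem mem_deficient {x v : V} :
    v ∈ deficient R x ↔ level R x v = 2 ∧ ∀ t, R.Adj v t → level R x t ≠ 2 := by
  simp [deficient]

section Triangle

open Classical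

variable {x : V}

/-- The neighbours of a deficient vertex are one vertex of level one and vertices of level three. -/
theorem exists_adj_level_three (hC : NoC4 R) (hdeg : ∀ v, 2 ≤ R.degree v) {w : V}
    (hw : w ∈ deficient R x) : ∃ z, R.Adj w z ∧ level R x z = 3 := by
  rw [mem_deficient] at hw
  obtain ⟨h2, hw⟩ := hw
  obtain ⟨hwx, hxw, p, hp, hpw⟩ := level_eq_two.1 h2
  obtain ⟨z, hz, hzp⟩ : ∃ z, R.Adj w z ∧ z ≠ p := by
    by_contra! h
    have : R.degree w ≤ 1 := by
      rw [← card_neighborFinset_eq_degree, Finset.card_le_one]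
      intro u hu v hv
      rw [mem_neighborFinset] at hu hv
      rw [h u hu, h v hv]
    have := hdeg w
    omega
  refine ⟨z, hz, ?_⟩
  have h0 : level R x z ≠ 0 := by
    rw [Ne, level_eq_zero]
    rintro rfl
    exact hxw hz.symm
  have h1 : level R x z ≠ 1 := by
    rw [Ne, level_eq_one]
    intro h
    rcases hC x p w z hp hpw hz h.symm with h' | h'
    · exact hwx h'.symm
    · exact hzp h'.symm
  have := hw z hz
  have := @level_le_three V R x z
  omega

/-- A level-three vertex adjacent to a deficient vertex `w` and of charge three lies in a pendant
triangle at `w`. -/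
theorem exists_pendant_triangle (hS : PathSaturated R) (hdeg : ∀ v, 2 ≤ R.degree v)
    (hT : ∀ v, R.degree v = 2 → ∀ u w, R.Adj v u → R.Adj v w → u ≠ w → R.Adj u w)
    {w z : V} (hz3 : level R x z = 3) (hwz : R.Adj w z)
    (hz : charge R (level R x) z ≤ 3) :
    ∃ z', R.Adj z z' ∧ R.Adj w z' ∧ ∀ t, R.Adj z t → t = w ∨ t = z' := by
  have h1 := degree_lt_charge hS hz3
  have h2 := hdeg z
  have hd : R.degree z = 2 := by omega
  obtain ⟨z', hz', hne⟩ : ∃ z', R.Adj z z' ∧ z' ≠ w := by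
    by_contra! h
    have : R.degree z ≤ 1 := by
      rw [← card_neighborFinset_eq_degree, Finset.card_le_one]
      intro u hu v hv
      rw [mem_neighborFinset] at hu hv
      rw [h u hu, h v hv]
    omega
  exact ⟨z', hz', hT z hd w z' hwz.symm hz' hne.symm,
    fun t ht => eq_or_eq_of_degree_eq_two hd hwz.symm hz' hne.symm ht⟩

/-- If every level-three neighbour of the deficient vertex `w` has charge three, then no other
vertex is deficient. -/
theorem eq_of_deficient (hC : NoC4 R) (hS : PathSaturated R) (hdeg : ∀ v, 2 ≤ R.degree v)
    (hT : ∀ v, R.degree v = 2 → ∀ u w, R.Adj v u → R.Adj v w → u ≠ w → R.Adj u w)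
    {w : V} (hw : w ∈ deficient R x)
    (hbad : ∀ z, R.Adj w z → level R x z = 3 → charge R (level R x) z ≤ 3)
    {w' : V} (hw' : w' ∈ deficient R x) : w' = w := by
  by_contra hne
  obtain ⟨z, hz, hz3⟩ := exists_adj_level_three hC hdeg hw
  obtain ⟨y, hy, hy3⟩ := exists_adj_level_three hC hdeg hw'
  have hw2 := (mem_deficient.1 hw).1
  have hw2' := (mem_deficient.1 hw').1
  have hwy : ¬ R.Adj w y := by
    intro h
    have := hbad y h hy3
    have := four_le_charge_of_two_lower hy3 h.symm hy.symm hw2 hw2' (Ne.symm hne)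
    omega
  obtain ⟨z', hzz', hwz', hzn⟩ := exists_pendant_triangle hS hdeg hT hz3 hz (hbad z hz hz3)
  have hz3' : level R x z' = 3 := by
    have h1 := two_le_level_of_adj hz3 hzz'
    have h2 := (mem_deficient.1 hw).2 z' hwz'
    have := @level_le_three V R x z'
    omega
  have hzy : z ≠ y := by
    rintro rfl
    exact hwy hz
  have hzy' : ¬ R.Adj z y := by
    intro h
    rcases hzn y h with rfl | rfl
    · omega
    · exact hwy hwz'
  -- A path of length three from `z` cannot leave the pendant triangles at `w` in time to reach `y`.
  obtain ⟨s, t, hs, hst, hty, htz, hsy⟩ := hS z y hzy hzy'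
  rcases hzn s hs with rfl | rfl
  · have ht3 : level R x t = 3 := by
      have h1 := two_le_level_of_adj hy3 hty.symm
      have h2 := (mem_deficient.1 hw).2 t hst
      have := @level_le_three V R x t
      omega
    obtain ⟨t', -, hwt', htn⟩ := exists_pendant_triangle hS hdeg hT ht3 hst (hbad t hst ht3)
    rcases htn y hty with rfl | rfl
    · exact hsy rfl
    · exact hwy hwt'
  · obtain ⟨u, -, -, hun⟩ := exists_pendant_triangle hS hdeg hT hz3' hwz' (hbad s hwz' hz3')
    have h1 : z = w ∨ z = u := hun z hzz'.symm
    rcases h1 with h1 | rfl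
    · exact hz.ne h1.symm
    rcases hun t hst with rfl | rfl
    · exact hwy hty
    · exact htz rfl

/-- A level-three vertex with excess charge can pay one unit to each deficient neighbour. -/
theorem card_deficient_neighbors_le (hdeg : ∀ v, 2 ≤ R.degree v)
    (hT : ∀ v, R.degree v = 2 → ∀ u w, R.Adj v u → R.Adj v w → u ≠ w → R.Adj u w)
    {z : V} (hz3 : level R x z = 3) (hz : 4 ≤ charge R (level R x) z) :
    3 + ((deficient R x).filter fun w => R.Adj z w).card ≤ charge R (level R x) z := by
  have hsub : ((deficient R x).filter fun w => R.Adj z w) ⊆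
      Finset.univ.filter fun w => R.Adj z w ∧ level R x w < level R x z := by
    intro w hw
    rw [Finset.mem_filter, mem_deficient] at hw
    simp only [Finset.mem_filter, Finset.mem_univ, true_and]
    exact ⟨hw.2, by omega⟩
  have h1 := Finset.card_le_card hsub
  have h2 := charge_of_level_three hz3
  have h3 : (Finset.univ.filter fun w => R.Adj z w ∧ level R x w < level R x z).card ≤
      R.degree z := by
    rw [← card_neighborFinset_eq_degree]
    refine Finset.card_le_card fun w hw => ?_
    rw [mem_neighborFinset]
    exact (Finset.mem_filter.1 hw).2.1
  have h4 := hdeg z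
  -- The only case not settled by arithmetic: here the two deficient neighbours would be adjacent by
  -- `hT`, hence not deficient.
  by_cases h5 : ((deficient R x).filter fun w => R.Adj z w).card = 2 ∧ R.degree z = 2
  · obtain ⟨u, hu, w, hw, huw⟩ := Finset.one_lt_card.1
      (by omega : 1 < ((deficient R x).filter fun w => R.Adj z w).card)
    rw [Finset.mem_filter, mem_deficient] at hu hw
    exact absurd hw.1.1 (hu.1.2 w (hT z h5.2 u w hu.2 hw.2 huw))
  · omega

/-- Only the root (by three) and the deficient vertices (by one) fall short. Either some deficient
vertex has no rich level-three neighbour and is then the only deficient one, or every deficient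
vertex is paid by such a neighbour. -/
theorem three_mul_card_le_of_triangle (hC : NoC4 R) (hS : PathSaturated R)
    (hdeg : ∀ v, 2 ≤ R.degree v)
    (hT : ∀ v, R.degree v = 2 → ∀ u w, R.Adj v u → R.Adj v w → u ≠ w → R.Adj u w)
    (hx : R.degree x = 2) : 3 * Fintype.card V ≤ ∑ v, R.degree v + 4 := by
  have base : ∀ v, 3 ≤ charge R (level R x) v + (if v = x then 3 else 0) +
      (if v ∈ deficient R x then 1 else 0) := by
    intro v
    have hle := @level_le_three V R x v
    by_cases hvx : v = x
    · rw [if_pos hvx]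
      omega
    rcases (by rw [← level_eq_zero (R := R)] at hvx; omega :
      level R x v = 1 ∨ level R x v = 2 ∨ level R x v = 3) with h | h | h
    · have hxv := level_eq_one.1 h
      obtain ⟨u, hu, huv⟩ : ∃ u, R.Adj x u ∧ u ≠ v := by
        by_contra! h
        have : R.degree x ≤ 1 := by
          rw [← card_neighborFinset_eq_degree, Finset.card_le_one]
          intro u hu v hv
          rw [mem_neighborFinset] at hu hv
          rw [h u hu, h v hv]
        omega
      have := three_le_charge (l := level R x) hxv.symm (by rw [h, level_self]; omega)
        (hT x hx v u hxv hu huv.symm) (by rw [h, level_eq_one.2 hu])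
      omega
    · obtain ⟨-, -, w, hw, hwv⟩ := level_eq_two.1 h
      have hlt : level R x w < level R x v := by rw [level_eq_one.2 hw, h]; omega
      have h2 := two_le_charge hwv.symm hlt
      by_cases hd : v ∈ deficient R x
      · rw [if_pos hd]
        omega
      · obtain ⟨t, ht, ht2⟩ : ∃ t, R.Adj v t ∧ level R x t = 2 := by
          by_contra! hcon
          exact hd (mem_deficient.2 ⟨h, hcon⟩)
        have := three_le_charge hwv.symm hlt ht (ht2.trans h.symm)
        omega
    · have := degree_lt_charge hS h
      have := hdeg v
      omega
  have hcharge : ∑ v, charge R (level R x) v = ∑ v, R.degree v := sum_charge R _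
  by_cases hbad : ∃ w ∈ deficient R x,
      ∀ z, R.Adj w z → level R x z = 3 → charge R (level R x) z ≤ 3
  · obtain ⟨w, hw, hbad⟩ := hbad
    have hone : (deficient R x).card ≤ 1 := by
      rw [Finset.card_le_one]
      intro u hu v hv
      rw [eq_of_deficient hC hS hdeg hT hw hbad hu, eq_of_deficient hC hS hdeg hT hw hbad hv]
    have hsum := Finset.sum_le_sum fun v (_ : v ∈ (Finset.univ : Finset V)) => base v
    simp only [Finset.sum_add_distrib, ← Finset.card_filter, Finset.filter_univ_mem,
      Finset.sum_const, Finset.card_univ, smul_eq_mul, Finset.sum_ite_eq', Finset.mem_univ,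
      if_true, hcharge] at hsum
    omega
  · push Not at hbad
    choose! f hf1 hf2 hf3 using hbad
    have key : ∀ v, 3 + ((deficient R x).filter fun w => f w = v).card ≤
        charge R (level R x) v + (if v = x then 3 else 0) +
        (if v ∈ deficient R x then 1 else 0) := by
      intro v
      rcases Finset.eq_empty_or_nonempty ((deficient R x).filter fun w => f w = v) with h | ⟨w, hw⟩
      · rw [h, Finset.card_empty]
        exact base v
      · obtain ⟨hwD, rfl⟩ := Finset.mem_filter.1 hw
        have h1 := card_deficient_neighbors_le hdeg hT (hf2 w hwD) (hf3 w hwD)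
        have h2 : ((deficient R x).filter fun u => f u = f w).card ≤
            ((deficient R x).filter fun u => R.Adj (f w) u).card := by
          refine Finset.card_le_card fun u hu => ?_
          rw [Finset.mem_filter] at hu ⊢
          exact ⟨hu.1, hu.2 ▸ (hf1 u hu.1).symm⟩
        omega
    have hsum := Finset.sum_le_sum fun v (_ : v ∈ (Finset.univ : Finset V)) => key v
    rw [Finset.sum_add_distrib, ← Finset.card_eq_sum_card_fiberwise
      (f := f) (s := deficient R x) (t := Finset.univ) (fun _ _ => by simp)] at hsum
    simp only [Finset.sum_add_distrib, ← Finset.card_filter, Finset.filter_univ_mem,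
      Finset.sum_const, Finset.card_univ, smul_eq_mul, Finset.sum_ite_eq', Finset.mem_univ,
      if_true, hcharge] at hsum
    omega

end Triangle

open Classical in
theorem three_mul_card_add_card_le (hC : NoC4 R) (hS : PathSaturated R)
    (hn : 3 ≤ Fintype.card V) {A : Finset V} (hA : IsFlexible R A) :
    3 * Fintype.card V + A.card ≤ ∑ v, R.degree v + 7 := by
  have hA3 : A.card ≤ 3 := hC.clique_card_le fun p hp q hq hpq => (hA p hp q hq hpq).1
  have hpos : ∀ v, ∃ w, R.Adj v w := by
    intro v
    obtain ⟨u, hu⟩ := Fintype.exists_ne_of_one_lt_card (by omega) v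
    by_cases h : R.Adj v u
    · exact ⟨u, h⟩
    · obtain ⟨s, -, hs, -⟩ := hS v u hu.symm h
      exact ⟨s, hs⟩
  by_cases h1 : ∃ x, R.degree x = 1
  · obtain ⟨x, hx⟩ := h1
    exact three_mul_card_add_card_le_of_leaf hC hS hn hpos hA hx
  have hdeg : ∀ v, 2 ≤ R.degree v := by
    intro v
    have h2 := (R.degree_pos_iff_exists_adj v).2 (hpos v)
    have h3 : R.degree v ≠ 1 := fun h => h1 ⟨v, h⟩
    omega
  by_cases h2 : ∃ x, R.degree x = 2
  · obtain ⟨x, hx⟩ := h2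
    by_cases hI : ∃ x, R.degree x = 2 ∧ ∀ u v, R.Adj x u → R.Adj x v → ¬ R.Adj u v
    · obtain ⟨x, hx, hI⟩ := hI
      exact three_mul_card_add_card_le_of_independent hC hS hdeg hA hx hI
    · push Not at hI
      have := three_mul_card_le_of_triangle hC hS hdeg (fun v hv u w hu hw huw => by
        obtain ⟨s, t, hs, ht, hst⟩ := hI v hv
        rcases eq_or_eq_of_degree_eq_two hv hs ht hst.ne hu with rfl | rfl <;>
          rcases eq_or_eq_of_degree_eq_two hv hs ht hst.ne hw with rfl | rfl
        · exact absurd rfl huw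
        · exact hst
        · exact hst.symm
        · exact absurd rfl huw) hx
      omega
  · have h3 : ∀ v ∈ (Finset.univ : Finset V), 3 ≤ R.degree v := by
      intro v _
      have h4 := hdeg v
      have h5 : R.degree v ≠ 2 := fun h => h2 ⟨v, h⟩
      omega
    have := Finset.card_nsmul_le_sum _ _ _ h3
    rw [Finset.card_univ, smul_eq_mul] at this
    omega

end

/-! ### From co-critical graphs to saturated red graphs. -/

section

variable {V : Type*}

theorem exists_path_of_not_noC4_sup_edge {R : SimpleGraph V} (hC : NoC4 R) {u v : V}
    (h : ¬ NoC4 (R ⊔ edge u v)) :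
    ∃ s t, R.Adj u s ∧ R.Adj s t ∧ R.Adj t v ∧ t ≠ u ∧ s ≠ v := by
  by_contra! hno
  -- After rotating the C₄ so that the new edge comes first, its other three edges lie in `R`.
  have one : ∀ a b c d, (R ⊔ edge u v).Adj b c → (R ⊔ edge u v).Adj c d →
      (R ⊔ edge u v).Adj d a → a ≠ c → b ≠ d → (a = u ∧ b = v ∨ a = v ∧ b = u) → False := by
    intro a b c d hbc hcd hda hac hbd hab
    have nbc := hbc.ne
    have ncd := hcd.ne
    have nda := hda.ne
    simp only [sup_adj, edge_adj] at hbc hcd hda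
    have hbc' : R.Adj b c := by grind
    have hcd' : R.Adj c d := by grind
    have hda' : R.Adj d a := by grind
    rcases hab with ⟨rfl, rfl⟩ | ⟨rfl, rfl⟩
    · exact hbd (hno d c hda'.symm hcd'.symm hbc'.symm hac.symm).symm
    · exact hac (hno c d hbc' hcd' hda' hbd.symm).symm
  refine h fun a b c d hab hbc hcd hda => ?_
  by_contra! hne
  have hab' : R.Adj a b ∨ (a = u ∧ b = v ∨ a = v ∧ b = u) := by
    simp only [sup_adj, edge_adj] at hab; tauto
  have hbc' : R.Adj b c ∨ (b = u ∧ c = v ∨ b = v ∧ c = u) := by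
    simp only [sup_adj, edge_adj] at hbc; tauto
  have hcd' : R.Adj c d ∨ (c = u ∧ d = v ∨ c = v ∧ d = u) := by
    simp only [sup_adj, edge_adj] at hcd; tauto
  have hda' : R.Adj d a ∨ (d = u ∧ a = v ∨ d = v ∧ a = u) := by
    simp only [sup_adj, edge_adj] at hda; tauto
  rcases hab' with hab' | h
  · rcases hbc' with hbc' | h
    · rcases hcd' with hcd' | h
      · rcases hda' with hda' | h
        · rcases hC a b c d hab' hbc' hcd' hda' with h | h
          · exact hne.1 h
          · exact hne.2 h
        · exact one d a b c hab hbc hcd hne.2.symm hne.1 h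
      · exact one c d a b hda hab hbc hne.1.symm hne.2.symm h
    · exact one b c d a hcd hda hab hne.2 hne.1.symm h
  · exact one a b c d hbc hcd hda hne.1 hne.2 h

theorem NoC4.mono {R R' : SimpleGraph V} (hC : NoC4 R) (h : R' ≤ R) : NoC4 R' :=
  fun a b c d hab hbc hcd hda => hC a b c d (h hab) (h hbc) (h hcd) (h hda)

theorem AtMostOne.mono {B B' : SimpleGraph V} (hB : AtMostOne B) (h : B' ≤ B) : AtMostOne B' :=
  fun v u w hu hw => hB v u w (h hu) (h hw)

/-- A blue edge may be added between two vertices without blue neighbours. -/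
theorem AtMostOne.sup_edge {B : SimpleGraph V} (hB : AtMostOne B) {p q : V}
    (hp : ∀ w, ¬ B.Adj p w) (hq : ∀ w, ¬ B.Adj q w) : AtMostOne (B ⊔ edge p q) := by
  intro v u w hu hw
  simp only [sup_adj, edge_adj] at hu hw
  rcases hu with hu | ⟨hu, hne⟩ <;> rcases hw with hw | ⟨hw, hne'⟩
  · exact hB v u w hu hw
  · rcases hw with ⟨rfl, rfl⟩ | ⟨rfl, rfl⟩
    · exact absurd hu (hp _)
    · exact absurd hu (hq _)
  · rcases hu with ⟨rfl, rfl⟩ | ⟨rfl, rfl⟩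
    · exact absurd hw (hp _)
    · exact absurd hw (hq _)
  · rcases hu with ⟨rfl, rfl⟩ | ⟨rfl, rfl⟩ <;> rcases hw with ⟨h, rfl⟩ | ⟨h, rfl⟩ <;> simp_all

theorem IsCoCritical.two_mul_sub_three_le [Fintype V] {G : SimpleGraph V}
    (hn : 3 ≤ Fintype.card V) (hG : IsCoCritical C4 (K1 2) G) :
    2 * Fintype.card V - 3 ≤ G.edgeSet.ncard := by
  classical
  rw [isCoCritical_iff] at hG
  obtain ⟨-, ⟨R₀, hR₀⟩, hadd⟩ := hG
  obtain ⟨R, ⟨hle, hC, hB⟩, hmax⟩ :=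
    (Set.toFinite {R | R ≤ G ∧ NoC4 R ∧ AtMostOne (G \ R)}).exists_maximal ⟨R₀, hR₀⟩
  have hS : PathSaturated R := by
    intro u v huv hadj
    refine exists_path_of_not_noC4_sup_edge hC fun hC' => ?_
    by_cases hGuv : G.Adj u v
    · have hmem : R ⊔ edge u v ∈ {R | R ≤ G ∧ NoC4 R ∧ AtMostOne (G \ R)} :=
        ⟨sup_le hle ((edge_le_iff _).2 (.inr hGuv)), hC',
          hB.mono (sdiff_le_sdiff_left le_sup_left)⟩
      have := hmax hmem le_sup_left
      exact hadj (this (by simp [edge_adj, huv]))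
    · refine hadd u v huv hGuv (R ⊔ edge u v) (sup_le_sup_right hle _) hC' (hB.mono ?_)
      intro a b hab
      simp only [sdiff_adj, sup_adj] at hab ⊢
      tauto
  let A : Finset V := Finset.univ.filter fun v => ∀ w, ¬ (G \ R).Adj v w
  have hA : IsFlexible R A := by
    intro p hp q hq hpq
    replace hp : ∀ w, ¬ (G \ R).Adj p w := (Finset.mem_filter.1 hp).2
    replace hq : ∀ w, ¬ (G \ R).Adj q w := (Finset.mem_filter.1 hq).2
    refine ⟨?_, fun x hxp hadj => ?_⟩
    · by_contra hR
      have hGpq : ¬ G.Adj p q := fun h => hp q ⟨h, hR⟩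
      refine hadd p q hpq hGpq R (hle.trans le_sup_left) hC ((hB.sup_edge hp hq).mono ?_)
      intro a b hab
      simp only [sdiff_adj, sup_adj] at hab ⊢
      tauto
    · have hGxp : ¬ G.Adj x p := fun h => hp x ⟨h.symm, fun h' => hadj h'.symm⟩
      -- Recolour `pq` blue, which is allowed as both ends miss the blue matching, and add `xp` in
      -- red: the resulting C₄ cannot use `pq`.
      have hle' : R \ edge p q ≤ R := sdiff_le
      obtain ⟨s, t, hs, hst, htp, htx, hsp⟩ := exists_path_of_not_noC4_sup_edge (hC.mono hle')
        (u := x) (v := p) fun hC' => by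
          refine hadd x p hxp hGxp (R \ edge p q ⊔ edge x p)
            (sup_le_sup_right (hle'.trans hle) _) hC' ((hB.sup_edge hp hq).mono ?_)
          intro a b hab
          simp only [sdiff_adj, sup_adj] at hab ⊢
          tauto
      refine ⟨s, t, hs.1, hst.1, htp.1, htx, hsp, ?_⟩
      rintro rfl
      exact htp.2 (by simp [edge_adj, hpq, hpq.symm])
  have hsum := three_mul_card_add_card_le hC hS hn hA
  have hdeg : ∀ v, R.degree v + 1 ≤ G.degree v + (if v ∈ A then 1 else 0) := by
    intro v
    have hsub : R.neighborFinset v ⊆ G.neighborFinset v := fun w hw => by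
      rw [mem_neighborFinset] at hw ⊢
      exact hle hw
    rw [← card_neighborFinset_eq_degree, ← card_neighborFinset_eq_degree]
    by_cases hv : v ∈ A
    · have := Finset.card_le_card hsub
      rw [if_pos hv]
      omega
    · rw [if_neg hv]
      have hv' : ∃ w, (G \ R).Adj v w := by
        by_contra! h
        exact hv (Finset.mem_filter.2 ⟨Finset.mem_univ _, h⟩)
      obtain ⟨w, hw⟩ := hv'
      refine Finset.card_lt_card ⟨hsub, fun h => hw.2 ?_⟩
      have := h ((mem_neighborFinset ..).2 hw.1)
      rwa [mem_neighborFinset] at this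
  have hsum' := Finset.sum_le_sum fun v (_ : v ∈ (Finset.univ : Finset V)) => hdeg v
  simp only [Finset.sum_add_distrib, ← Finset.card_filter, Finset.filter_univ_mem,
    Finset.sum_const, Finset.card_univ, smul_eq_mul, sum_degrees_eq_twice_card_edges] at hsum' hsum
  rw [← coe_edgeFinset, Set.ncard_coe_finset]
  omega

end

/-! ### Local obstructions to critical colourings. -/

section

variable {V : Type*} {G R : SimpleGraph V}

/-- A complete graph on four vertices has no critical colouring. -/
theorem false_of_k4 (hC : NoC4 R) (hB : AtMostOne (G \ R)) {a b c d : V} (hab : G.Adj a b)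
    (hac : G.Adj a c) (had : G.Adj a d) (hbc : G.Adj b c) (hbd : G.Adj b d) (hcd : G.Adj c d) :
    False := by
  have one : ∀ v u w, G.Adj v u → G.Adj v w → u ≠ w → R.Adj v u ∨ R.Adj v w := by
    intro v u w hu hw huw
    by_contra! h
    exact huw (hB v u w ⟨hu, h.1⟩ ⟨hw, h.2⟩)
  have h1 := hC a b c d
  have h2 := hC a b d c
  have h3 := hC a c b d
  have a1 := one a b c hab hac hbc.ne
  have a2 := one a b d hab had hbd.ne
  have a3 := one a c d hac had hcd.ne
  have b1 := one b a c hab.symm hbc hac.ne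
  have b2 := one b a d hab.symm hbd had.ne
  have b3 := one b c d hbc hbd hcd.ne
  have c1 := one c a b hac.symm hbc.symm hab.ne
  have c2 := one c a d hac.symm hcd had.ne
  have c3 := one c b d hbc.symm hcd hbd.ne
  have d1 := one d a b had.symm hbd.symm hab.ne
  have d2 := one d a c had.symm hcd.symm hac.ne
  have d3 := one d b c hbd.symm hcd.symm hbc.ne
  have n1 := hab.ne
  have n2 := hac.ne
  have n3 := had.ne
  have n4 := hbc.ne
  have n5 := hbd.ne
  have n6 := hcd.ne
  simp only [R.adj_comm b a, R.adj_comm c a, R.adj_comm d a, R.adj_comm c b, R.adj_comm d b,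
    R.adj_comm d c] at *
  grind

/-- In a copy of `K₄` minus an edge, the common edge of the two triangles is red. -/
theorem red_of_two_common_neighbors (hC : NoC4 R) (hB : AtMostOne (G \ R)) {p u v w : V}
    (hpu : G.Adj p u) (hpv : G.Adj p v) (hpw : G.Adj p w) (huv : G.Adj u v) (huw : G.Adj u w)
    (hvw : v ≠ w) : R.Adj p u := by
  by_contra h
  -- If `pu` were blue, all other edges at `p` and `u` would be red, making `p v u w` a red C₄.
  have red : ∀ v, G.Adj p v → G.Adj u v → R.Adj p v ∧ R.Adj u v := by
    intro v hpv huv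
    constructor
    · by_contra h'
      exact huv.ne (hB p u v ⟨hpu, h⟩ ⟨hpv, h'⟩)
    · by_contra h'
      exact hpv.ne (hB u v p ⟨huv, h'⟩ ⟨hpu.symm, fun h'' => h h''.symm⟩).symm
  have hv' := red v hpv huv
  have hw' := red w hpw huw
  rcases hC p v u w hv'.1 hv'.2.symm hw'.2 hw'.1.symm with h | h
  · exact hpu.ne h
  · exact hvw h

/-- A vertex `v` other than the dominating vertex `p` with three neighbours, each of which is joined
to `p` by a red edge, obstructs critical colourings. -/
theorem false_of_three_red (hC : NoC4 R) (hB : AtMostOne (G \ R)) {p v a b c : V} (hv : v ≠ p)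
    (ha : R.Adj p a) (hb : R.Adj p b) (hc : R.Adj p c) (hva : G.Adj v a) (hvb : G.Adj v b)
    (hvc : G.Adj v c) (hab : a ≠ b) (hac : a ≠ c) (hbc : b ≠ c) : False := by
  have one : ∀ a b, R.Adj p a → R.Adj p b → a ≠ b → R.Adj v a → ¬ R.Adj v b := by
    intro a b ha hb hab hva hvb
    rcases hC p a v b ha hva.symm hvb hb.symm with h | h
    · exact hv h.symm
    · exact hab h
  have two : ∀ a b, G.Adj v a → G.Adj v b → a ≠ b → R.Adj v a ∨ R.Adj v b := by
    intro a b hva hvb hab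
    by_contra! h
    exact hab (hB v a b ⟨hva, h.1⟩ ⟨hvb, h.2⟩)
  have := one a b ha hb hab
  have := one a c ha hc hac
  have := one b c hb hc hbc
  have := two a b hva hvb hab
  have := two a c hva hvc hac
  have := two b c hvb hvc hbc
  tauto

/-! ### Extremal graphs on at least seven vertices. -/

section Large

variable {n t : ℕ}

/-- The vertex `0` joined to the disjoint union of a path on `1, …, t` and a cycle on
`t + 1, …, n - 1`. -/
def hubGraph (n t : ℕ) : SimpleGraph (Fin n) :=
  SimpleGraph.fromRel fun i j => (i.val = 0 ∧ j.val ≠ 0) ∨ (1 ≤ i.val ∧ j.val = i.val + 1 ∧ i.val ≠ t) ∨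
    (i.val = t + 1 ∧ j.val + 1 = n)

/-- The red edges of a critical colouring of `hubGraph`: all edges at `0`, and every other edge of
the path and the cycle. -/
def hubRed (n : ℕ) : SimpleGraph (Fin n) :=
  SimpleGraph.fromRel fun i j => (i.val = 0 ∧ j.val ≠ 0) ∨
    (1 ≤ i.val ∧ j.val = i.val + 1 ∧ i.val % 2 = n % 2)

theorem hubGraph_adj {i j : Fin n} : (hubGraph n t).Adj i j ↔ i.val ≠ j.val ∧
    (((i.val = 0 ∧ j.val ≠ 0) ∨ (1 ≤ i.val ∧ j.val = i.val + 1 ∧ i.val ≠ t) ∨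
      (i.val = t + 1 ∧ j.val + 1 = n)) ∨
    ((j.val = 0 ∧ i.val ≠ 0) ∨ (1 ≤ j.val ∧ i.val = j.val + 1 ∧ j.val ≠ t) ∨
      (j.val = t + 1 ∧ i.val + 1 = n))) := by
  simp [hubGraph, Fin.ext_iff]

theorem hubRed_adj {i j : Fin n} : (hubRed n).Adj i j ↔ i.val ≠ j.val ∧
    (((i.val = 0 ∧ j.val ≠ 0) ∨ (1 ≤ i.val ∧ j.val = i.val + 1 ∧ i.val % 2 = n % 2)) ∨
    ((j.val = 0 ∧ i.val ≠ 0) ∨ (1 ≤ j.val ∧ i.val = j.val + 1 ∧ j.val % 2 = n % 2))) := by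
  simp [hubRed, Fin.ext_iff]

theorem hubRed_noC4 : NoC4 (hubRed n) := by
  have uniq : ∀ v u w : Fin n, v.val ≠ 0 → u.val ≠ 0 → w.val ≠ 0 → (hubRed n).Adj v u →
      (hubRed n).Adj v w → u = w := by
    intro v u w hv hu hw hvu hvw
    rw [hubRed_adj] at hvu hvw
    ext
    omega
  have zero : ∀ u v : Fin n, u.val = 0 → v.val = 0 → u = v := fun u v hu hv =>
    Fin.ext (hu.trans hv.symm)
  have half : ∀ a b c d : Fin n, (hubRed n).Adj a b → (hubRed n).Adj b c → (hubRed n).Adj c d →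
      (hubRed n).Adj d a → b.val ≠ 0 → d.val ≠ 0 → a = c ∨ b = d := by
    intro a b c d hab hbc hcd hda hb hd
    by_cases ha : a.val = 0
    · by_cases hc : c.val = 0
      · exact .inl (zero a c ha hc)
      · exact .inr (uniq c b d hc hb hd hbc.symm hcd)
    · exact .inr (uniq a b d ha hb hd hab hda.symm)
  intro a b c d hab hbc hcd hda
  by_cases hbd : b.val ≠ 0 ∧ d.val ≠ 0
  · exact half a b c d hab hbc hcd hda hbd.1 hbd.2
  by_cases hac : a.val ≠ 0 ∧ c.val ≠ 0
  · exact (half b c d a hbc hcd hda hab hac.2 hac.1).symm.imp Eq.symm id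
  -- Now the hub is one of `a`, `c` and also one of `b`, `d`, although these are adjacent.
  exfalso
  rw [hubRed_adj] at hab hbc hcd hda
  omega

/-- The nonadjacent pair `t`, `t + 1` is not red because `t` and `n` have opposite parity. -/
theorem hubRed_le (ht : (t + n) % 2 = 1) : hubRed n ≤ hubGraph n t := by
  intro i j h
  rw [hubRed_adj] at h
  rw [hubGraph_adj]
  omega

theorem hubGraph_sdiff_atMostOne (ht : (t + n) % 2 = 1) (htn : t + 5 ≤ n) :
    AtMostOne (hubGraph n t \ hubRed n) := by
  intro v u w hu hw
  rw [sdiff_adj, hubGraph_adj, hubRed_adj] at hu hw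
  ext
  have := u.isLt
  have := v.isLt
  have := w.isLt
  omega

theorem exists_two_cycle_neighbors (htn : t + 5 ≤ n) (v : Fin n) (hv : t < v.val) :
    ∃ a b : Fin n, a ≠ b ∧ t < a.val ∧ t < b.val ∧
      (hubGraph n t).Adj v a ∧ (hubGraph n t).Adj v b := by
  have := v.isLt
  rcases (by omega : v.val = t + 1 ∨ v.val + 1 = n ∨ t + 1 < v.val ∧ v.val + 1 < n) with h | h | h
  · refine ⟨⟨t + 2, by omega⟩, ⟨n - 1, by omega⟩, ?_, ?_, ?_, ?_, ?_⟩ <;>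
      simp only [hubGraph_adj, ne_eq, Fin.ext_iff] <;> omega
  · refine ⟨⟨t + 1, by omega⟩, ⟨n - 2, by omega⟩, ?_, ?_, ?_, ?_, ?_⟩ <;>
      simp only [hubGraph_adj, ne_eq, Fin.ext_iff, true_and] <;> omega
  · refine ⟨⟨v.val - 1, by omega⟩, ⟨v.val + 1, by omega⟩, ?_, ?_, ?_, ?_, ?_⟩ <;>
      simp only [hubGraph_adj, ne_eq, Fin.ext_iff, true_and] <;> omega

theorem exists_neighbor (ht : 2 ≤ t) (htn : t + 5 ≤ n) (v : Fin n) :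
    ∃ a : Fin n, a.val ≠ 0 ∧ (hubGraph n t).Adj v a := by
  have := v.isLt
  by_cases h : v.val = t ∨ v.val + 1 = n
  · refine ⟨⟨v.val - 1, by omega⟩, ?_, ?_⟩ <;> simp only [hubGraph_adj] <;> omega
  · refine ⟨⟨v.val + 1, by omega⟩, ?_, ?_⟩ <;> simp only [hubGraph_adj, true_and] <;> omega

/-- Spokes to cycle vertices lie in two triangles and are red. A new edge `vu` with `v` on the cycle
also puts the spoke to `u` in two triangles, so `v` has three neighbours on red spokes. A new edge
off the cycle joins the ends of the three-vertex path and completes a K₄. -/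
theorem not_atMostOne_hubGraph_sup_edge (ht : t = 2 ∨ t = 3) (htn : t + 5 ≤ n) {x y : Fin n}
    (hxy : x ≠ y) (hadj : ¬ (hubGraph n t).Adj x y) {R : SimpleGraph (Fin n)} (hC : NoC4 R) :
    ¬ AtMostOne ((hubGraph n t ⊔ edge x y) \ R) := by
  intro hB
  have hle : hubGraph n t ≤ hubGraph n t ⊔ edge x y := le_sup_left
  have hnew : (hubGraph n t ⊔ edge x y).Adj x y := by simp [edge_adj, hxy]
  have hxy' : x.val ≠ y.val := fun h => hxy (Fin.ext h)
  obtain ⟨p, hp0⟩ : ∃ p : Fin n, p.val = 0 := ⟨⟨0, by omega⟩, rfl⟩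
  have hne : ∀ v : Fin n, v ≠ p ↔ v.val ≠ 0 := fun v => by rw [Ne, Fin.ext_iff, hp0]
  have hp' : ∀ v, v ≠ p → (hubGraph n t).Adj p v := by
    intro v hv
    rw [hne] at hv
    rw [hubGraph_adj]
    omega
  have hp : ∀ v, v ≠ p → (hubGraph n t ⊔ edge x y).Adj p v := fun v hv => hle (hp' v hv)
  have hxp : x ≠ p := by
    rintro rfl
    exact hadj (hp' y hxy.symm)
  have hyp : y ≠ p := by
    rintro rfl
    exact hadj (hp' x hxy).symm
  have cyc : ∀ v u : Fin n, v ≠ u → u ≠ p → ¬ (hubGraph n t).Adj v u →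
      (hubGraph n t ⊔ edge x y).Adj v u → t < v.val → False := by
    intro v u hvu hup hvu' hnew hv
    have hvp : v ≠ p := (hne v).2 (by omega)
    have other : ∀ a : Fin n, t < a.val → (hubGraph n t).Adj v a → R.Adj p a := by
      intro a ha hva
      obtain ⟨b, c, hbc, hb, hc, hab, hac⟩ := exists_two_cycle_neighbors htn a ha
      exact red_of_two_common_neighbors hC hB (hp a ((hne a).2 (by omega))) (hp b ((hne b).2 (by omega)))
        (hp c ((hne c).2 (by omega))) (hle hab) (hle hac) hbc
    obtain ⟨a, b, hab, ha, hb, hva, hvb⟩ := exists_two_cycle_neighbors htn v hv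
    obtain ⟨w, hw, huw⟩ := exists_neighbor (by omega) htn u
    have hu := red_of_two_common_neighbors hC hB (hp u hup) (hp v hvp) (hp w ((hne w).2 hw)) hnew.symm
      (hle huw) (by
      rintro rfl
      exact hvu' huw.symm)
    refine false_of_three_red hC hB hvp (other a ha hva) (other b hb hvb) hu (hle hva) (hle hvb)
      hnew hab ?_ ?_
    · rintro rfl
      exact hvu' hva
    · rintro rfl
      exact hvu' hvb
  by_cases hx : t < x.val
  · exact cyc x y hxy hyp hadj hnew hx
  by_cases hy : t < y.val
  · exact cyc y x hxy.symm hxp (fun h => hadj h.symm) hnew.symm hy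
  obtain ⟨m, hm⟩ : ∃ m : Fin n, m.val = 2 := ⟨⟨2, by omega⟩, rfl⟩
  have hx0 := (hne x).1 hxp
  have hy0 := (hne y).1 hyp
  have hmp : m ≠ p := (hne m).2 (by omega)
  have h13 : t = 3 ∧ (x.val = 1 ∧ y.val = 3 ∨ x.val = 3 ∧ y.val = 1) := by
    rw [hubGraph_adj] at hadj
    omega
  have hmx : (hubGraph n t).Adj m x := by
    rw [hubGraph_adj]
    omega
  have hmy : (hubGraph n t).Adj m y := by
    rw [hubGraph_adj]
    omega
  exact false_of_k4 hC hB (hp m hmp) (hp x hxp) (hp y hyp) (hle hmx) (hle hmy) hnew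

theorem hubGraph_isCoCritical (ht : t = 2 ∨ t = 3) (htn : t + 5 ≤ n) (hpar : (t + n) % 2 = 1) :
    IsCoCritical C4 (K1 2) (hubGraph n t) := by
  rw [isCoCritical_iff]
  refine ⟨fun h => ?_, ⟨hubRed n, hubRed_le hpar, hubRed_noC4,
    hubGraph_sdiff_atMostOne hpar htn⟩, fun x y hxy hadj R _ hC =>
    not_atMostOne_hubGraph_sup_edge ht htn hxy hadj hC⟩
  have : (hubGraph n t).Adj ⟨1, by omega⟩ ⟨t + 2, by omega⟩ := by
    rw [h, top_adj, Ne, Fin.ext_iff]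
    simp
  rw [hubGraph_adj] at this
  simp only at this
  omega

open Classical in
theorem hubGraph_ncard (ht : 2 ≤ t) (htn : t + 5 ≤ n) :
    (hubGraph n t).edgeSet.ncard = 2 * n - 3 := by
  -- With the index as level, a vertex has two smaller neighbours, except none for the hub, one for
  -- `1` and `t + 1`, and three for `n - 1`. The total is 4n - 6.
  have key : ∀ v : Fin n, charge (hubGraph n t) Fin.val v + (if v = ⟨0, by omega⟩ then 4 else 0) +
      (if v = ⟨1, by omega⟩ then 2 else 0) + (if v = ⟨t + 1, by omega⟩ then 2 else 0) =
      4 + (if v = ⟨n - 1, by omega⟩ then 2 else 0) := by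
    intro v
    have hv := v.isLt
    have same : (Finset.univ.filter fun w => (hubGraph n t).Adj v w ∧ w.val = v.val) = ∅ := by
      rw [Finset.filter_eq_empty_iff]
      rintro w - ⟨h, h'⟩
      rw [hubGraph_adj] at h
      omega
    simp only [charge, Fin.ext_iff, same, Finset.card_empty, add_zero]
    have lower : ∀ S : Finset (Fin n), (∀ w : Fin n, w ∈ S ↔ (w.val = 0 ∧ v.val ≠ 0) ∨
        (1 ≤ w.val ∧ v.val = w.val + 1 ∧ w.val ≠ t) ∨ (w.val = t + 1 ∧ v.val + 1 = n)) →
        (Finset.univ.filter fun w => (hubGraph n t).Adj v w ∧ w.val < v.val) = S := by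
      intro S hS
      ext w
      rw [hS, Finset.mem_filter, hubGraph_adj]
      simp only [Finset.mem_univ, true_and]
      omega
    by_cases h0 : v.val = 0
    · rw [lower ∅ (by intro w; simp only [Finset.notMem_empty, false_iff]; omega)]
      split_ifs <;> first | omega | simp
    by_cases h1 : v.val = 1 ∨ v.val = t + 1
    · rw [lower {⟨0, by omega⟩} (by
        intro w; simp only [Finset.mem_singleton, Fin.ext_iff]; omega), Finset.card_singleton]
      split_ifs <;> omega
    by_cases h2 : v.val + 1 = n
    · rw [lower {⟨0, by omega⟩, ⟨v.val - 1, by omega⟩, ⟨t + 1, by omega⟩} (by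
        intro w; simp only [Finset.mem_insert, Finset.mem_singleton, Fin.ext_iff]; omega),
        Finset.card_eq_three.2 ⟨_, _, _, by simp only [ne_eq, Fin.ext_iff]; omega,
          by simp only [ne_eq, Fin.ext_iff]; omega, by simp only [ne_eq, Fin.ext_iff]; omega, rfl⟩]
      split_ifs <;> omega
    · rw [lower {⟨0, by omega⟩, ⟨v.val - 1, by omega⟩} (by
        intro w; simp only [Finset.mem_insert, Finset.mem_singleton, Fin.ext_iff]; omega),
        Finset.card_pair (by simp only [ne_eq, Fin.ext_iff]; omega)]
      split_ifs <;> omega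
  have hsum := Finset.sum_congr (rfl : (Finset.univ : Finset (Fin n)) = Finset.univ)
    fun v _ => key v
  have hcharge : ∑ v, charge (hubGraph n t) Fin.val v = ∑ v, (hubGraph n t).degree v :=
    sum_charge _ _
  simp only [Finset.sum_add_distrib, Finset.sum_const, Finset.card_univ, Fintype.card_fin,
    smul_eq_mul, Finset.sum_ite_eq', Finset.mem_univ, if_true, hcharge,
    sum_degrees_eq_twice_card_edges] at hsum
  rw [← coe_edgeFinset, Set.ncard_coe_finset]
  omega

end Large

/-! ### Extremal graphs on five and six vertices. -/

section Small

/-- Three triangles with a common edge. -/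
def book : SimpleGraph (Fin 5) :=
  SimpleGraph.fromRel fun i j =>
    (i, j) ∈ [((0 : Fin 5), (1 : Fin 5)), (0, 2), (0, 3), (0, 4), (1, 2), (1, 3), (1, 4)]

instance : DecidableRel book.Adj := fun _ _ => inferInstanceAs (Decidable (_ ∧ _))

/-- The red edges of a critical colouring of `book`. -/
def bookRed : SimpleGraph (Fin 5) :=
  SimpleGraph.fromRel fun i j =>
    (i, j) ∈ [((0 : Fin 5), (1 : Fin 5)), (0, 2), (0, 3), (1, 2), (1, 4)]

instance : DecidableRel bookRed.Adj := fun _ _ => inferInstanceAs (Decidable (_ ∧ _))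

theorem book_isCoCritical : IsCoCritical C4 (K1 2) book := by
  rw [isCoCritical_iff]
  refine ⟨fun h => ?_, ⟨bookRed, ?_, ?_, ?_⟩, fun x y hxy hadj R _ hC hB => ?_⟩
  · have : book.Adj 2 3 := by rw [h]; decide
    revert this
    decide
  · intro i j
    revert i j
    decide
  · unfold NoC4
    decide
  · unfold AtMostOne
    simp only [sdiff_adj]
    decide
  · have hall : ∀ x y, x ≠ y → ¬ book.Adj x y → book.Adj 0 1 ∧ book.Adj 0 x ∧ book.Adj 0 y ∧
        book.Adj 1 x ∧ book.Adj 1 y := by decide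
    obtain ⟨h1, h2, h3, h4, h5⟩ := hall x y hxy hadj
    exact false_of_k4 hC hB (Or.inl h1) (Or.inl h2) (Or.inl h3) (Or.inl h4) (Or.inl h5)
      (by simp [edge_adj, hxy])

theorem book_ncard : book.edgeSet.ncard = 7 := by
  rw [← coe_edgeFinset, Set.ncard_coe_finset]
  decide

/-- A triangle with a further triangle on each of its edges. -/
def sun : SimpleGraph (Fin 6) :=
  SimpleGraph.fromRel fun i j =>
    (i, j) ∈ [((0 : Fin 6), (1 : Fin 6)), (1, 2), (0, 2), (0, 3), (2, 3), (0, 4), (1, 4), (1, 5), (2, 5)]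

instance : DecidableRel sun.Adj := fun _ _ => inferInstanceAs (Decidable (_ ∧ _))

/-- The red edges of a critical colouring of `sun`. -/
def sunRed : SimpleGraph (Fin 6) :=
  SimpleGraph.fromRel fun i j =>
    (i, j) ∈ [((0 : Fin 6), (1 : Fin 6)), (1, 2), (0, 2), (0, 3), (1, 4), (2, 5)]

instance : DecidableRel sunRed.Adj := fun _ _ => inferInstanceAs (Decidable (_ ∧ _))

/-- A triangle `abc` with triangles `acx`, `aby`, `bcz` on its edges, together with the edge `xy`,
has no critical colouring. -/
theorem false_of_sun_add_edge (hC : NoC4 R) (hB : AtMostOne (G \ R)) {a b c x y z : V}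
    (hab : G.Adj a b) (hbc : G.Adj b c) (hac : G.Adj a c) (hax : G.Adj a x) (hcx : G.Adj c x)
    (hay : G.Adj a y) (hby : G.Adj b y) (hbz : G.Adj b z) (hcz : G.Adj c z) (hxy : G.Adj x y)
    (hbx : b ≠ x) (hcy : c ≠ y) (haz : a ≠ z) (hxz : x ≠ z) (hyz : y ≠ z) : False := by
  have rb := red_of_two_common_neighbors hC hB hab hac hay hbc hby hcy
  have rc := red_of_two_common_neighbors hC hB hac hab hax hbc.symm hcx hbx
  have rx := red_of_two_common_neighbors hC hB hax hac hay hcx.symm hxy hcy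
  have ry := red_of_two_common_neighbors hC hB hay hab hax hby.symm hxy.symm hbx
  -- If `uz` were blue, `uv` and `uw` would be red and `a v u w` a red C₄. Applied at `b` and `c`,
  -- this makes `a b z c` a red C₄.
  have red : ∀ u v w, R.Adj a v → R.Adj a w → a ≠ u → v ≠ w → G.Adj u v → G.Adj u w →
      G.Adj u z → v ≠ z → w ≠ z → R.Adj u z := by
    intro u v w hv hw hau hvw huv huw huz hvz hwz
    by_contra h
    have hv' : R.Adj u v := by
      by_contra h'
      exact hvz (hB u v z ⟨huv, h'⟩ ⟨huz, h⟩)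
    have hw' : R.Adj u w := by
      by_contra h'
      exact hwz (hB u w z ⟨huw, h'⟩ ⟨huz, h⟩)
    rcases hC a v u w hv hv'.symm hw' hw.symm with h | h
    · exact hau h
    · exact hvw h
  have hbz' := red b c y rc ry hab.ne hcy hbc hby hbz hcz.ne hyz
  have hcz' := red c b x rb rx hac.ne hbx hbc.symm hcx hcz hbz.ne hxz
  rcases hC a b z c rb hbz' hcz'.symm rc.symm with h | h
  · exact haz h
  · exact hbc.ne h

theorem sun_isCoCritical : IsCoCritical C4 (K1 2) sun := by
  rw [isCoCritical_iff]
  refine ⟨fun h => ?_, ⟨sunRed, ?_, ?_, ?_⟩, fun x y hxy hadj R _ hC hB => ?_⟩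
  · have : sun.Adj 3 4 := by rw [h]; decide
    revert this
    decide
  · intro i j
    revert i j
    decide
  · unfold NoC4
    decide
  · unfold AtMostOne
    simp only [sdiff_adj]
    decide
  · have hnew : (sun ⊔ edge x y).Adj x y := by simp [edge_adj, hxy]
    have hcases : ∀ x y, x ≠ y → ¬ sun.Adj x y →
        (x = 3 ∧ y = 1 ∨ x = 4 ∧ y = 2 ∨ x = 5 ∧ y = 0 ∨ x = 3 ∧ y = 4 ∨ x = 3 ∧ y = 5 ∨
          x = 4 ∧ y = 5) ∨
        (y = 3 ∧ x = 1 ∨ y = 4 ∧ x = 2 ∨ y = 5 ∧ x = 0 ∨ y = 3 ∧ x = 4 ∨ y = 3 ∧ x = 5 ∨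
          y = 4 ∧ x = 5) := by decide
    have main : ∀ x y, (sun ⊔ edge x y).Adj x y → NoC4 R → AtMostOne ((sun ⊔ edge x y) \ R) →
        (x = 3 ∧ y = 1 ∨ x = 4 ∧ y = 2 ∨ x = 5 ∧ y = 0 ∨ x = 3 ∧ y = 4 ∨ x = 3 ∧ y = 5 ∨
          x = 4 ∧ y = 5) → False := by
      intro x y hnew hC hB h
      have old : ∀ i j, sun.Adj i j → (sun ⊔ edge x y).Adj i j := fun i j h => Or.inl h
      rcases h with ⟨rfl, rfl⟩ | ⟨rfl, rfl⟩ | ⟨rfl, rfl⟩ | ⟨rfl, rfl⟩ | ⟨rfl, rfl⟩ | ⟨rfl, rfl⟩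
      · exact false_of_k4 (a := 0) (b := 2) (c := 3) (d := 1) hC hB (old _ _ (by decide))
          (old _ _ (by decide)) (old _ _ (by decide)) (old _ _ (by decide)) (old _ _ (by decide)) hnew
      · exact false_of_k4 (a := 0) (b := 1) (c := 4) (d := 2) hC hB (old _ _ (by decide))
          (old _ _ (by decide)) (old _ _ (by decide)) (old _ _ (by decide)) (old _ _ (by decide)) hnew
      · exact false_of_k4 (a := 1) (b := 2) (c := 5) (d := 0) hC hB (old _ _ (by decide))
          (old _ _ (by decide)) (old _ _ (by decide)) (old _ _ (by decide)) (old _ _ (by decide)) hnew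
      -- In these three cases `a` is the common neighbour of the two outer vertices being joined.
      · refine false_of_sun_add_edge (a := 0) (b := 1) (c := 2) (x := 3) (y := 4) (z := 5) hC hB
          ?_ ?_ ?_ ?_ ?_ ?_ ?_ ?_ ?_ hnew ?_ ?_ ?_ ?_ ?_ <;> decide
      · refine false_of_sun_add_edge (a := 2) (b := 1) (c := 0) (x := 3) (y := 5) (z := 4) hC hB
          ?_ ?_ ?_ ?_ ?_ ?_ ?_ ?_ ?_ hnew ?_ ?_ ?_ ?_ ?_ <;> decide
      · refine false_of_sun_add_edge (a := 1) (b := 2) (c := 0) (x := 4) (y := 5) (z := 3) hC hB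
          ?_ ?_ ?_ ?_ ?_ ?_ ?_ ?_ ?_ hnew ?_ ?_ ?_ ?_ ?_ <;> decide
    rcases hcases x y hxy hadj with h | h
    · exact main x y hnew hC hB h
    · rw [edge_comm] at hB hnew
      exact main y x hnew.symm hC hB h

theorem sun_ncard : sun.edgeSet.ncard = 9 := by
  rw [← coe_edgeFinset, Set.ncard_coe_finset]
  decide

end Small

theorem exists_isCoCritical_ncard_eq {n : ℕ} (hn : 5 ≤ n) :
    ∃ G : SimpleGraph (Fin n), IsCoCritical C4 (K1 2) G ∧ G.edgeSet.ncard = 2 * n - 3 := by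
  rcases (by omega : n = 5 ∨ n = 6 ∨ 7 ≤ n) with rfl | rfl | h
  · exact ⟨book, book_isCoCritical, book_ncard⟩
  · exact ⟨sun, sun_isCoCritical, sun_ncard⟩
  · rcases Nat.mod_two_eq_zero_or_one n with h2 | h2
    · exact ⟨hubGraph n 3, hubGraph_isCoCritical (.inr rfl) (by omega) (by omega),
        hubGraph_ncard (by omega) (by omega)⟩
    · exact ⟨hubGraph n 2, hubGraph_isCoCritical (.inl rfl) (by omega) (by omega),
        hubGraph_ncard (by omega) (by omega)⟩

end

end CoCritical

theorem theorem1p5 :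
    (∀ (n : ℕ), 5 ≤ n → ∀ (V : Type*) [Fintype V] (G : SimpleGraph V), Fintype.card V = n →
      CoCritical.IsCoCritical CoCritical.C4 (CoCritical.K1 2) G →
        2 * n - 3 ≤ G.edgeSet.ncard) ∧
    (∀ (n : ℕ), 5 ≤ n → ∃ G : SimpleGraph (Fin n),
      CoCritical.IsCoCritical CoCritical.C4 (CoCritical.K1 2) G ∧
        G.edgeSet.ncard = 2 * n - 3) := by
  refine ⟨fun n hn V _ G hV hG => ?_, fun n hn => CoCritical.exists_isCoCritical_ncard_eq hn⟩
  subst hV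
  exact hG.two_mul_sub_three_le (by omega)
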